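/- Let $q\in L^1_{loc}(\mathbb R)$ be real valued and even, and suppose that the differential expression $\tau_q y=-y''-qy$ on $\mathbb R$ is in the limit circle case at $+\infty$ and at $-\infty$, i.e. for every $\lambda\in\mathbb C$ all solutions of $\tau_q y=\lambda y$ are square integrable near $+\infty$ and near $-\infty$. Let $$\mathcal D_{\max}=\{y\in L^2(\mathbb R): y,y'\in AC_{loc}(\mathbb R),\ \tau_q y\in L^2(\mathbb R)\},$$ let $A_{\max}y=\tau_q y$ on $\mathcal D_{\max}$, let $A$ be the minimal operator, i.e. the closure of the restriction of $A_{\max}$ to the functions in $\mathcal D_{\max}$ with compact support, and recall that $A^*=A_{\max}$. A bi-extension of $A$ is a closed operator $\widetilde A$ with $A\subset\widetilde A\subset A^*$. Let $(\mathcal Pf)(x)=f(-x)$ and let $\widetilde A^+=\mathcal P\widetilde A^*\mathcal P$ be the adjoint of $\widetilde A$ in the Krein space $(L^2(\mathbb R),[\cdot,\cdot])$, $[f,g]=\int_{\mathbb R} f(x)\overline{g(-x)}\,dx$. For $f,g\in\mathcal D_{\max}$ put $[f,g]_x=\overline{f(x)}g'(x)-\overline{f'(x)}g(x)$ and $[f,g]_{\pm\infty}=\lim_{x\to\pm\infty}[f,g]_x$.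 Let $w_1,w_2\in\mathcal D_{\max}$ be real valued solutions of $\tau_q y=0$, $w_1$ odd and $w_2$ even, with $[w_1,w_2]_{-\infty}=[w_1,w_2]_{\infty}=1$, and put, for $f\in\mathcal D_{\max}$ and $j=1,2$, $$\alpha_j(f)=[w_j,f]_{-\infty},\qquad \beta_j(f)=[w_j,f]_{\infty}.$$ Let $\alpha,\beta,\gamma,\delta\in\mathbb C$ and let $\widetilde A$ be a bi-extension of $A$. (i) Suppose that for some $a_1,b_1\in\mathbb C$ with $|a_1|+|b_1|\neq0$ $$\operatorname{dom}\widetilde A=\Big\{f\in\mathcal D_{\max}: a_1\alpha_1(f)+b_1\alpha_2(f)=0,\ \begin{bmatrix}\alpha&\beta\\ \gamma&\delta\end{bmatrix}\begin{pmatrix}\alpha_1(f)\\ \alpha_2(f)\end{pmatrix}=\begin{pmatrix}\beta_1(f)\\ \beta_2(f)\end{pmatrix}\Big\}\qquad\text{(type I)}.$$ Put $$a=\overline{a_1},\quad b=\overline{b_1},\quad \begin{pmatrix}c\\ d\end{pmatrix}=-\begin{bmatrix}\overline\delta&-\overline\gamma\\ -\overline\beta&\overline\alpha\end{bmatrix}\begin{pmatrix}\overline{a_1}\\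 \overline{b_1}\end{pmatrix}.$$ Then $$\operatorname{dom}\widetilde A^*=\{g\in\mathcal D_{\max}: a\,\alpha_1(g)+b\,\alpha_2(g)+c\,\beta_1(g)+d\,\beta_2(g)=0\},$$ $$\operatorname{dom}\widetilde A^+=\mathcal P\operatorname{dom}\widetilde A^*=\{h\in\mathcal D_{\max}: a\,\beta_1(h)-b\,\beta_2(h)+c\,\alpha_1(h)-d\,\alpha_2(h)=0\}.$$ (ii) Suppose that for some $c_1,d_1\in\mathbb C$ with $|c_1|+|d_1|\neq0$ $$\operatorname{dom}\widetilde A=\Big\{f\in\mathcal D_{\max}: c_1\beta_1(f)+d_1\beta_2(f)=0,\ \begin{bmatrix}\alpha&\beta\\ \gamma&\delta\end{bmatrix}\begin{pmatrix}\beta_1(f)\\ \beta_2(f)\end{pmatrix}=\begin{pmatrix}\alpha_1(f)\\ \alpha_2(f)\end{pmatrix}\Big\}\qquad\text{(type II)}.$$ Put $$c=\overline{c_1},\quad d=\overline{d_1},\quad \begin{pmatrix}a\\ b\end{pmatrix}=-\begin{bmatrix}\overline\delta&-\overline\gamma\\ -\overline\beta&\overline\alpha\end{bmatrix}\begin{pmatrix}\overline{c_1}\\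 \overline{d_1}\end{pmatrix}.$$ Then the same two formulas for $\operatorname{dom}\widetilde A^*$ and $\operatorname{dom}\widetilde A^+=\mathcal P\operatorname{dom}\widetilde A^*$ hold with these $a,b,c,d$. -/

import Mathlib

open MeasureTheory Filter Topology Matrix
open scoped ComplexConjugate LinearPMap

noncomputable section

namespace PTSymm

/-- The complex Hilbert space `L²(ℝ)`. -/
abbrev L2R : Type := Lp ℂ 2 (volume : Measure ℝ)

/-- `AC_loc(ℝ)`: absolutely continuous on every compact interval. -/
def ACLoc (y : ℝ → ℂ) : Prop := ∀ a b : ℝ, AbsolutelyContinuousOnInterval y a b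

/-- `y, y' ∈ AC_loc(ℝ)`, where `y'` is the everywhere defined derivative of `y`. -/
structure IsACTwo (y : ℝ → ℂ) : Prop where
  diff : Differentiable ℝ y
  ac : ACLoc y
  ac_deriv : ACLoc (deriv y)

/-- The differential expression `τ_q y = - y'' - q y`. For `y, y' ∈ AC_loc(ℝ)` the second
derivative exists almost everywhere. -/
def tau (q : ℝ → ℝ) (y : ℝ → ℂ) (x : ℝ) : ℂ := -deriv (deriv y) x - (q x : ℂ) * y x

/-- `y` solves `τ_q y - lam y = 0` on `ℝ` (in the Carathéodory sense). -/
def IsSolution (q : ℝ → ℝ) (lam : ℂ) (y : ℝ → ℂ) : Prop :=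
  IsACTwo y ∧ ∀ᵐ x, tau q y x - lam * y x = 0

/-- Limit circle case at `+∞`. -/
def LimitCircleAtTop (q : ℝ → ℝ) : Prop :=
  ∀ (lam : ℂ) (y : ℝ → ℂ), IsSolution q lam y →
    ∃ a : ℝ, MemLp y 2 (volume.restrict (Set.Ioi a))

/-- Limit circle case at `-∞`. -/
def LimitCircleAtBot (q : ℝ → ℝ) : Prop :=
  ∀ (lam : ℂ) (y : ℝ → ℂ), IsSolution q lam y →
    ∃ a : ℝ, MemLp y 2 (volume.restrict (Set.Iio a))

/-- Membership in the maximal domain of `τ_q`. -/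
structure InMaxDomain (q : ℝ → ℝ) (y : ℝ → ℂ) : Prop where
  ac : IsACTwo y
  memLp : MemLp y 2 volume
  memLp_tau : MemLp (tau q y) 2 volume

theorem ACLoc.ae_differentiableAt {y : ℝ → ℂ} (h : ACLoc y) :
    ∀ᵐ x, DifferentiableAt ℝ y x := by
  have hn : ∀ n : ℕ, ∀ᵐ x : ℝ, x ∈ Set.uIcc (-(n : ℝ)) n → DifferentiableAt ℝ y x := fun n =>
    (h _ _).boundedVariationOn.ae_differentiableAt_of_mem_uIcc
  filter_upwards [ae_all_iff.2 hn] with x hx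
  obtain ⟨n, hxn⟩ := exists_nat_ge |x|
  refine hx n ?_
  rw [Set.uIcc_of_le (by linarith [abs_nonneg x])]
  exact abs_le.1 hxn

theorem IsACTwo.add {y z : ℝ → ℂ} (hy : IsACTwo y) (hz : IsACTwo z) : IsACTwo (y + z) where
  diff := hy.diff.add hz.diff
  ac a b := (hy.ac a b).add (hz.ac a b)
  ac_deriv a b := by
    have : deriv (y + z) = deriv y + deriv z := by
      ext x; exact deriv_add (hy.diff x) (hz.diff x)
    rw [this]
    exact (hy.ac_deriv a b).add (hz.ac_deriv a b)

theorem IsACTwo.smul {y : ℝ → ℂ} (c : ℂ) (hy : IsACTwo y) : IsACTwo (c • y) where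
  diff := hy.diff.const_smul c
  ac a b := (hy.ac a b).const_smul c
  ac_deriv a b := by
    have : deriv (c • y) = fun x => c • deriv y x := by
      ext x; exact deriv_const_smul c (hy.diff x)
    rw [this]
    exact (hy.ac_deriv a b).const_smul c

theorem IsACTwo.zero : IsACTwo (0 : ℝ → ℂ) where
  diff := differentiable_const 0
  ac a b := by simpa using! (contDiff_const (c := (0 : ℂ))).contDiffOn.absolutelyContinuousOnInterval
  ac_deriv a b := by
    have : deriv (0 : ℝ → ℂ) = fun _ => 0 := by ext x; simp
    rw [this]
    exact (contDiff_const (c := (0 : ℂ))).contDiffOn.absolutelyContinuousOnInterval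

theorem tau_add_ae (q : ℝ → ℝ) {y z : ℝ → ℂ} (hy : IsACTwo y) (hz : IsACTwo z) :
    tau q (y + z) =ᵐ[volume] tau q y + tau q z := by
  have hd : deriv (y + z) = deriv y + deriv z := by
    ext x; exact deriv_add (hy.diff x) (hz.diff x)
  filter_upwards [hy.ac_deriv.ae_differentiableAt, hz.ac_deriv.ae_differentiableAt] with x h1 h2
  simp only [tau, hd, Pi.add_apply]
  rw [deriv_add h1 h2]
  ring

theorem tau_smul (q : ℝ → ℝ) (c : ℂ) {y : ℝ → ℂ} (hy : IsACTwo y) :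
    tau q (c • y) = c • tau q y := by
  have hd : deriv (c • y) = c • deriv y := by
    ext x; exact deriv_const_smul c (hy.diff x)
  ext x
  simp only [tau, hd, Pi.smul_apply, smul_eq_mul]
  rw [show (c • deriv y) = fun t => c * deriv y t from rfl, deriv_const_mul_field]
  ring

theorem tau_zero (q : ℝ → ℝ) : tau q 0 = 0 := by
  have hd : deriv (0 : ℝ → ℂ) = 0 := by ext x; simp
  ext x
  simp [tau, hd]

/-- The maximal domain `D_max`, as a space of functions. -/
def maxDomain (q : ℝ → ℝ) : Submodule ℂ (ℝ → ℂ) where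
  carrier := {y | InMaxDomain q y}
  zero_mem' := ⟨IsACTwo.zero, MemLp.zero, by rw [tau_zero]; exact MemLp.zero⟩
  add_mem' hy hz := ⟨hy.ac.add hz.ac, hy.memLp.add hz.memLp,
    (hy.memLp_tau.add hz.memLp_tau).ae_eq (tau_add_ae q hy.ac hz.ac).symm⟩
  smul_mem' c _ hy := ⟨hy.ac.smul c, hy.memLp.const_smul c, by
    rw [tau_smul q c hy.ac]; exact hy.memLp_tau.const_smul c⟩

/-- A function of the maximal domain as an element of `L²(ℝ)`. -/
def toL2 (q : ℝ → ℝ) : maxDomain q →ₗ[ℂ] L2R where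
  toFun y := MemLp.toLp (y : ℝ → ℂ) y.2.memLp
  map_add' y z := MemLp.toLp_add y.2.memLp z.2.memLp
  map_smul' c y := MemLp.toLp_const_smul c y.2.memLp

/-- `y ↦ τ_q y` as a map from the maximal domain to `L²(ℝ)`. -/
def tauL2 (q : ℝ → ℝ) : maxDomain q →ₗ[ℂ] L2R where
  toFun y := MemLp.toLp (tau q y) y.2.memLp_tau
  map_add' y z := by
    rw [← MemLp.toLp_add y.2.memLp_tau z.2.memLp_tau]
    exact MemLp.toLp_congr _ _ (tau_add_ae q y.2.ac z.2.ac)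
  map_smul' c y := by
    rw [RingHom.id_apply, ← MemLp.toLp_const_smul c y.2.memLp_tau]
    exact MemLp.toLp_congr _ _ (by
      rw [show ((c • y : maxDomain q) : ℝ → ℂ) = c • (y : ℝ → ℂ) from rfl, tau_smul q c y.2.ac])

theorem toL2_injective (q : ℝ → ℝ) : Function.Injective (toL2 q) := by
  intro y z h
  have h' : (y : ℝ → ℂ) =ᵐ[volume] (z : ℝ → ℂ) :=
    (MemLp.toLp_eq_toLp_iff y.2.memLp z.2.memLp).1 h
  exact Subtype.ext
    ((y.2.ac.diff.continuous.ae_eq_iff_eq volume z.2.ac.diff.continuous).1 h')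

/-- The maximal operator `A_max`: it sends the class of `y ∈ D_max` to the class of `τ_q y`. -/
def maxOp (q : ℝ → ℝ) : L2R →ₗ.[ℂ] L2R where
  domain := LinearMap.range (toL2 q)
  toFun := tauL2 q ∘ₗ
    (LinearEquiv.ofInjective (toL2 q) (toL2_injective q)).symm.toLinearMap

theorem maxOp_apply (q : ℝ → ℝ) (y : maxDomain q) :
    maxOp q ⟨toL2 q y, LinearMap.mem_range_self _ y⟩ = tauL2 q y := by
  change tauL2 q ((LinearEquiv.ofInjective (toL2 q) (toL2_injective q)).symm _) = _
  congr 1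
  exact (LinearEquiv.symm_apply_eq _).2 rfl

/-- The functions of the maximal domain that have compact support. -/
def compactDomain (q : ℝ → ℝ) : Submodule ℂ (maxDomain q) where
  carrier := {y | HasCompactSupport (y : ℝ → ℂ)}
  zero_mem' := HasCompactSupport.zero
  add_mem' hy hz := HasCompactSupport.add hy hz
  smul_mem' c _ hy := HasCompactSupport.smul_left (f := fun _ : ℝ => c) hy

/-- The pre-minimal operator `A₀`. -/
def preminOp (q : ℝ → ℝ) : L2R →ₗ.[ℂ] L2R :=
  (maxOp q).domRestrict ((compactDomain q).map (toL2 q))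

/-- The minimal operator `A`, the closure of `A₀`. -/
def minOp (q : ℝ → ℝ) : L2R →ₗ.[ℂ] L2R := (preminOp q).closure

/-- `T` is a bi-extension of `A`: a closed operator with `A ⊆ T ⊆ A*`. -/
structure IsBiExtension (A T : L2R →ₗ.[ℂ] L2R) : Prop where
  closed : T.IsClosed
  le : A ≤ T
  le_adjoint : T ≤ A†

/-- The parity operator `(P f)(x) = f(-x)` on `L²(ℝ)`. -/
def parity : L2R →ₗ[ℂ] L2R :=
  Lp.compMeasurePreservingₗ ℂ (fun x : ℝ => -x) (Measure.measurePreserving_neg volume)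

/-- The adjoint `T⁺ = P T* P` in the Krein space `(L²(ℝ), [·,·])`,
`[f,g] = ∫ f(x) conj (g(-x)) dx`, whose fundamental symmetry is the parity `P`. -/
def kreinAdjoint (T : L2R →ₗ.[ℂ] L2R) : L2R →ₗ.[ℂ] L2R where
  domain := (T†).domain.comap parity
  toFun := parity ∘ₗ (T†).toFun ∘ₗ
    parity.restrict (p := (T†).domain.comap parity) (q := (T†).domain) (fun _ h => h)

/-- `[f,g]_x = conj (f x) g'(x) - conj (f'(x)) g(x)`. -/
def bracket (f g : ℝ → ℂ) (x : ℝ) : ℂ :=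
  conj (f x) * deriv g x - conj (deriv f x) * g x

/-- `[f,g]_{+∞}`. -/
def bracketTop (f g : ℝ → ℂ) : ℂ := limUnder atTop (bracket f g)

/-- `[f,g]_{-∞}`. -/
def bracketBot (f g : ℝ → ℂ) : ℂ := limUnder atBot (bracket f g)

/-- The normalized pair of real solutions `w₁` (odd), `w₂` (even) in `D_max` of `τ_q y = 0`. -/
structure IsBoundaryPair (q : ℝ → ℝ) (w₁ w₂ : ℝ → ℂ) : Prop where
  mem₁ : w₁ ∈ maxDomain q
  mem₂ : w₂ ∈ maxDomain q
  sol₁ : IsSolution q 0 w₁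
  sol₂ : IsSolution q 0 w₂
  real₁ : ∀ x, (w₁ x).im = 0
  real₂ : ∀ x, (w₂ x).im = 0
  odd₁ : Function.Odd w₁
  even₂ : Function.Even w₂
  tendsto_top : Tendsto (bracket w₁ w₂) atTop (𝓝 1)
  tendsto_bot : Tendsto (bracket w₁ w₂) atBot (𝓝 1)

end PTSymm

end

open PTSymm

/-! Everything reduces to linear algebra in the four boundary values. Green's formula turns the
defect of symmetry `⟨τf, g⟩ - ⟨f, τg⟩` into `[f,g]_∞ - [f,g]_{-∞}`. Since the Wronskian of `w₁, w₂`
is 1, each bracket is a symplectic form in the values `[w_j,f]`, `[w_j,g]` (`bracket_eq`).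
Analytically, the adjoint of any extension of the pre-minimal operator must be a restriction of the
maximal operator (`exists_of_mem_adjoint`). This rests on the regularity of weak solutions
(`exists_maxDomain_of_weak`), proved in the manner of du Bois-Reymond. Hence `g ∈ D_max` lies in
`dom T†` exactly when the two brackets of `g` with every `f ∈ dom T` agree (`toL2_mem_adjoint_iff`).
The boundary map is onto `ℂ⁴` (`exists_boundary_values`), so a type I domain has as boundary values
the line through `(b₁, -a₁)` and its image under the matrix. Its annihilator is one linear equation,
the stated one after conjugation (`forall_boundary_form_eq_iff`). Type II is the same with the two
ends exchanged. For the Krein space adjoint, parity exchanges the ends and, as `w₁` is odd and `w₂`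
even, reverses the sign of the second value only. -/

namespace PTSymm

/-! ### Locally absolutely continuous functions -/

theorem ACLoc.continuous {f : ℝ → ℂ} (hf : ACLoc f) : Continuous f := by
  refine continuous_iff_continuousAt.2 fun x => ?_
  refine (hf (x - 1) (x + 1)).continuousOn.continuousAt ?_
  rw [Set.uIcc_of_le (by linarith)]
  exact Icc_mem_nhds (by linarith) (by linarith)

theorem ACLoc.add {f g : ℝ → ℂ} (hf : ACLoc f) (hg : ACLoc g) : ACLoc fun x => f x + g x :=
  fun a b => (hf a b).add (hg a b)

theorem ACLoc.sub {f g : ℝ → ℂ} (hf : ACLoc f) (hg : ACLoc g) : ACLoc fun x => f x - g x :=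
  fun a b => (hf a b).sub (hg a b)

theorem ACLoc.mul {f g : ℝ → ℂ} (hf : ACLoc f) (hg : ACLoc g) : ACLoc fun x => f x * g x :=
  fun a b => (hf a b).smul (hg a b)

theorem ACLoc.conj {f : ℝ → ℂ} (hf : ACLoc f) : ACLoc fun x => conj (f x) := fun a b => by
  have := hf a b
  simp only [AbsolutelyContinuousOnInterval] at this ⊢
  refine this.congr fun E => Finset.sum_congr rfl fun i _ => ?_
  exact (Complex.dist_conj_conj _ _).symm

theorem ACLoc.ofReal {f : ℝ → ℝ} (hf : ∀ a b, AbsolutelyContinuousOnInterval f a b) :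
    ACLoc fun x => (f x : ℂ) := fun a b => by
  have := hf a b
  simp only [AbsolutelyContinuousOnInterval] at this ⊢
  refine this.congr fun E => Finset.sum_congr rfl fun i _ => ?_
  exact (Complex.isometry_ofReal.dist_eq _ _).symm

theorem ACLoc.const (c : ℂ) : ACLoc fun _ => c := fun _ _ =>
  contDiff_const.contDiffOn.absolutelyContinuousOnInterval

theorem _root_.MeasureTheory.LocallyIntegrable.intervalIntegrable_real {E : Type*}
    [NormedAddCommGroup E] {f : ℝ → E} (hf : LocallyIntegrable f volume) (a b : ℝ) :
    IntervalIntegrable f volume a b :=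
  intervalIntegrable_iff.mpr <|
    (hf.integrableOn_isCompact isCompact_uIcc).mono_set Set.uIoc_subset_uIcc

theorem ac_integral_real {f : ℝ → ℝ} (hf : LocallyIntegrable f volume) (c a b : ℝ) :
    AbsolutelyContinuousOnInterval (fun x => ∫ t in c..x, f t) a b := by
  have h := (hf.intervalIntegrable_real (min c (min a b))
    (max c (max a b))).absolutelyContinuousOnInterval_intervalIntegral (c := c)
    (by rw [Set.uIcc_of_le (by simp)]; simp)
  refine h.mono ?_
  rw [Set.uIcc_of_le (a := min c _) (by simp)]
  exact Set.Icc_subset_Icc (by simp) (by simp)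

theorem acLoc_integral {f : ℝ → ℂ} (hf : LocallyIntegrable f volume) (c : ℝ) :
    ACLoc fun x => ∫ t in c..x, f t := by
  have hre : LocallyIntegrable (fun x => (f x).re) volume := fun x => by
    obtain ⟨s, hs, h⟩ := hf x
    exact ⟨s, hs, h.re⟩
  have him : LocallyIntegrable (fun x => (f x).im) volume := fun x => by
    obtain ⟨s, hs, h⟩ := hf x
    exact ⟨s, hs, h.im⟩
  have h := (ACLoc.ofReal (ac_integral_real hre c)).add
    ((ACLoc.const Complex.I).mul (ACLoc.ofReal (ac_integral_real him c)))
  convert h using 2 with x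
  have hi := hf.intervalIntegrable_real c x
  have h1 := Complex.reCLM.intervalIntegral_comp_comm hi
  have h2 := Complex.imCLM.intervalIntegral_comp_comm hi
  simp only [Complex.reCLM_apply, Complex.imCLM_apply] at h1 h2
  rw [h1, h2, mul_comm, Complex.re_add_im]

/-- Subtracting the integral of `f` leaves an absolutely continuous function with derivative zero
almost everywhere, hence a constant. -/
theorem ACLoc.sub_eq_integral {F f : ℝ → ℂ} (hF : ACLoc F) (hf : LocallyIntegrable f volume)
    (hd : ∀ᵐ x, HasDerivAt F (f x) x) (a b : ℝ) : F b - F a = ∫ t in a..b, f t := by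
  have hG : ACLoc fun x => F x - ∫ t in a..x, f t := hF.sub (acLoc_integral hf a)
  obtain ⟨C, hC⟩ := (hG a b).const_of_ae_hasDerivAt_zero (by
    filter_upwards [hd, _root_.LocallyIntegrable.ae_hasDerivAt_integral hf] with x h1 h2 _
    simpa using! h1.sub (h2 a))
  have ha := hC a (by simp)
  have hb := hC b (by simp)
  simp only [intervalIntegral.integral_same, sub_zero] at ha hb
  rw [ha, ← hb]
  ring

/-- `F` is the integral of a continuous function, so the exceptional null set disappears. -/
theorem ACLoc.hasDerivAt_of_ae {F f : ℝ → ℂ} (hF : ACLoc F) (hf : Continuous f)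
    (hd : ∀ᵐ x, HasDerivAt F (f x) x) (x : ℝ) : HasDerivAt F (f x) x := by
  have h : F = fun x => F 0 + ∫ t in (0 : ℝ)..x, f t := by
    ext x
    rw [← hF.sub_eq_integral hf.locallyIntegrable hd 0 x]
    ring
  rw [h]
  exact (intervalIntegral.integral_hasDerivAt_right (hf.intervalIntegrable _ _)
    hf.stronglyMeasurable.stronglyMeasurableAtFilter hf.continuousAt).const_add _

theorem IsACTwo.ae_hasDerivAt_deriv (q : ℝ → ℝ) {y : ℝ → ℂ} (hy : IsACTwo y) :
    ∀ᵐ x, HasDerivAt (deriv y) (-tau q y x - q x * y x) x := by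
  filter_upwards [hy.ac_deriv.ae_differentiableAt] with x hx
  convert! hx.hasDerivAt using 1
  simp [tau]

theorem IsACTwo.continuous {y : ℝ → ℂ} (hy : IsACTwo y) : Continuous y := hy.diff.continuous

theorem IsACTwo.hasDerivAt {y : ℝ → ℂ} (hy : IsACTwo y) (x : ℝ) : HasDerivAt y (deriv y x) x :=
  (hy.diff x).hasDerivAt

/-- A locally absolutely continuous function whose derivative agrees almost everywhere with a
locally absolutely continuous one. -/
theorem IsACTwo.of_ae {y v : ℝ → ℂ} (hy : ACLoc y) (hv : ACLoc v)
    (hd : ∀ᵐ x, HasDerivAt y (v x) x) : IsACTwo y ∧ deriv y = v := by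
  have h := hy.hasDerivAt_of_ae hv.continuous hd
  have hdv : deriv y = v := funext fun x => (h x).deriv
  exact ⟨⟨fun x => (h x).differentiableAt, hy, hdv ▸ hv⟩, hdv⟩

theorem _root_.MeasureTheory.MemLp.locallyIntegrable_two {f : ℝ → ℂ} (hf : MemLp f 2 volume) :
    LocallyIntegrable f volume :=
  hf.locallyIntegrable (by norm_num)

theorem _root_.MeasureTheory.LocallyIntegrable.continuous_mul' {f g : ℝ → ℂ} (hf : Continuous f)
    (hg : LocallyIntegrable g volume) : LocallyIntegrable (fun x => f x * g x) volume := by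
  rw [locallyIntegrable_iff] at hg ⊢
  exact fun K hK => (hg K hK).continuousOn_mul hf.continuousOn hK

theorem _root_.MeasureTheory.LocallyIntegrable.conj' {f : ℝ → ℂ}
    (hf : LocallyIntegrable f volume) : LocallyIntegrable (fun x => conj (f x)) volume := by
  rw [locallyIntegrable_iff] at hf ⊢
  intro K hK
  exact (Complex.conjCLE.toContinuousLinearMap.integrable_comp (hf K hK))

theorem hasDerivAt_conj {f : ℝ → ℂ} {f' : ℂ} {x : ℝ} (h : HasDerivAt f f' x) :
    HasDerivAt (fun t => conj (f t)) (conj f') x := h.star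

theorem deriv_conj' {f : ℝ → ℂ} (hf : Differentiable ℝ f) (x : ℝ) :
    deriv (fun t => conj (f t)) x = conj (deriv f x) :=
  (hasDerivAt_conj (hf x).hasDerivAt).deriv

/-! ### The bracket and Green's formula -/

theorem acLoc_bracket {f g : ℝ → ℂ} (hf : IsACTwo f) (hg : IsACTwo g) : ACLoc (bracket f g) :=
  (hf.ac.conj.mul hg.ac_deriv).sub (hf.ac_deriv.conj.mul hg.ac)

theorem ae_hasDerivAt_bracket (q : ℝ → ℝ) {f g : ℝ → ℂ} (hf : IsACTwo f) (hg : IsACTwo g) :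
    ∀ᵐ x, HasDerivAt (bracket f g) (conj (tau q f x) * g x - conj (f x) * tau q g x) x := by
  filter_upwards [hf.ae_hasDerivAt_deriv q, hg.ae_hasDerivAt_deriv q] with x h1 h2
  have h := ((hasDerivAt_conj (hf.hasDerivAt x)).mul h2).sub
    ((hasDerivAt_conj h1).mul (hg.hasDerivAt x))
  refine h.congr_deriv ?_
  simp only [map_sub, map_neg, map_mul, Complex.conj_ofReal]
  ring

/-- Green's formula on a bounded interval. -/
theorem bracket_sub_bracket {q : ℝ → ℝ} {f g : ℝ → ℂ} (hf : IsACTwo f) (hg : IsACTwo g)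
    (hτf : LocallyIntegrable (tau q f) volume) (hτg : LocallyIntegrable (tau q g) volume)
    (a b : ℝ) : bracket f g b - bracket f g a =
      ∫ t in a..b, (conj (tau q f t) * g t - conj (f t) * tau q g t) := by
  refine (acLoc_bracket hf hg).sub_eq_integral ?_ (ae_hasDerivAt_bracket q hf hg) a b
  refine LocallyIntegrable.sub ?_ ?_
  · simpa only [mul_comm] using! hτf.conj'.continuous_mul' hg.continuous
  · exact hτg.continuous_mul' (Complex.continuous_conj.comp hf.continuous)

theorem memLp_conj {f : ℝ → ℂ} (hf : MemLp f 2 volume) :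
    MemLp (fun x => conj (f x)) 2 volume := hf.star

theorem integrable_conj_mul {f g : ℝ → ℂ} (hf : MemLp f 2 volume) (hg : MemLp g 2 volume) :
    Integrable (fun x => conj (f x) * g x) volume :=
  (memLp_conj hf).integrable_mul hg

theorem inner_toLp {f g : ℝ → ℂ} (hf : MemLp f 2 volume) (hg : MemLp g 2 volume) :
    inner ℂ (hf.toLp f) (hg.toLp g) = ∫ x, conj (f x) * g x := by
  rw [L2.inner_def]
  refine integral_congr_ae ?_
  filter_upwards [hf.coeFn_toLp, hg.coeFn_toLp] with x h1 h2
  rw [h1, h2, RCLike.inner_apply, mul_comm]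

section Limits

variable {q : ℝ → ℝ} {f g : ℝ → ℂ}

theorem InMaxDomain.integrable_green (hf : InMaxDomain q f) (hg : InMaxDomain q g) :
    Integrable (fun t => conj (tau q f t) * g t - conj (f t) * tau q g t) volume :=
  (integrable_conj_mul hf.memLp_tau hg.memLp).sub (integrable_conj_mul hf.memLp hg.memLp_tau)

theorem InMaxDomain.bracket_sub_bracket (hf : InMaxDomain q f) (hg : InMaxDomain q g) (a b : ℝ) :
    bracket f g b - bracket f g a =
      ∫ t in a..b, (conj (tau q f t) * g t - conj (f t) * tau q g t) :=
  PTSymm.bracket_sub_bracket hf.ac hg.ac hf.memLp_tau.locallyIntegrable_two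
    hg.memLp_tau.locallyIntegrable_two a b

/-- Green's integrand is integrable on the line, so the bracket converges; only then does the
`limUnder` in `bracketTop` carry meaning. -/
theorem InMaxDomain.tendsto_bracketTop (hf : InMaxDomain q f) (hg : InMaxDomain q g) :
    Tendsto (bracket f g) atTop (𝓝 (bracketTop f g)) := by
  have h := intervalIntegral_tendsto_integral_Ioi (0 : ℝ)
    (hf.integrable_green hg).integrableOn tendsto_id
  refine tendsto_nhds_limUnder ⟨_, (h.const_add (bracket f g 0)).congr fun x => ?_⟩
  rw [id, ← hf.bracket_sub_bracket hg]
  ring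

theorem InMaxDomain.tendsto_bracketBot (hf : InMaxDomain q f) (hg : InMaxDomain q g) :
    Tendsto (bracket f g) atBot (𝓝 (bracketBot f g)) := by
  have h := intervalIntegral_tendsto_integral_Iic (0 : ℝ)
    (hf.integrable_green hg).integrableOn tendsto_id
  refine tendsto_nhds_limUnder ⟨_, (h.const_sub (bracket f g 0)).congr fun x => ?_⟩
  rw [id, ← hf.bracket_sub_bracket hg]
  ring

/-- Green's formula on the line. -/
theorem InMaxDomain.bracketTop_sub_bracketBot (hf : InMaxDomain q f) (hg : InMaxDomain q g) :
    bracketTop f g - bracketBot f g =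
      ∫ t, (conj (tau q f t) * g t - conj (f t) * tau q g t) := by
  have h := intervalIntegral_tendsto_integral (hf.integrable_green hg)
    tendsto_neg_atTop_atBot tendsto_id
  refine tendsto_nhds_unique ?_ h
  refine ((hf.tendsto_bracketTop hg).sub
    ((hf.tendsto_bracketBot hg).comp tendsto_neg_atTop_atBot)).congr fun x => ?_
  rw [id, ← hf.bracket_sub_bracket hg]
  rfl

end Limits

theorem inner_tauL2_sub (q : ℝ → ℝ) (f g : maxDomain q) :
    inner ℂ (tauL2 q f) (toL2 q g) - inner ℂ (toL2 q f) (tauL2 q g) =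
      bracketTop f g - bracketBot f g := by
  have h1 := inner_toLp f.2.memLp_tau g.2.memLp
  have h2 := inner_toLp f.2.memLp g.2.memLp_tau
  have h3 := integral_sub (integrable_conj_mul f.2.memLp_tau g.2.memLp)
    (integrable_conj_mul f.2.memLp g.2.memLp_tau)
  rw [InMaxDomain.bracketTop_sub_bracketBot f.2 g.2, h3, ← h1, ← h2]
  rfl

/-! ### The pair `w₁, w₂` and variation of parameters -/

theorem IsSolution.ae_tau_eq_zero {q : ℝ → ℝ} {y : ℝ → ℂ} (h : IsSolution q 0 y) :
    ∀ᵐ x, tau q y x = 0 := by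
  filter_upwards [h.2] with x hx
  simpa using hx

theorem conj_deriv_of_im_eq_zero {w : ℝ → ℂ} (hd : Differentiable ℝ w) (h : ∀ x, (w x).im = 0)
    (x : ℝ) : conj (deriv w x) = deriv w x := by
  have hw : (fun t => conj (w t)) = w := funext fun t => Complex.conj_eq_iff_im.2 (h t)
  rw [← deriv_conj' hd, hw]

namespace IsBoundaryPair

variable {q : ℝ → ℝ} {w₁ w₂ : ℝ → ℂ}

theorem conj₁ (hw : IsBoundaryPair q w₁ w₂) (x : ℝ) : conj (w₁ x) = w₁ x :=
  Complex.conj_eq_iff_im.2 (hw.real₁ x)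

theorem conj₂ (hw : IsBoundaryPair q w₁ w₂) (x : ℝ) : conj (w₂ x) = w₂ x :=
  Complex.conj_eq_iff_im.2 (hw.real₂ x)

theorem conj_deriv₁ (hw : IsBoundaryPair q w₁ w₂) (x : ℝ) : conj (deriv w₁ x) = deriv w₁ x :=
  conj_deriv_of_im_eq_zero hw.sol₁.1.diff hw.real₁ x

theorem conj_deriv₂ (hw : IsBoundaryPair q w₁ w₂) (x : ℝ) : conj (deriv w₂ x) = deriv w₂ x :=
  conj_deriv_of_im_eq_zero hw.sol₂.1.diff hw.real₂ x

theorem bracket₁ (hw : IsBoundaryPair q w₁ w₂) (f : ℝ → ℂ) (x : ℝ) :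
    bracket w₁ f x = w₁ x * deriv f x - deriv w₁ x * f x := by
  rw [bracket, hw.conj₁, hw.conj_deriv₁]

theorem bracket₂ (hw : IsBoundaryPair q w₁ w₂) (f : ℝ → ℂ) (x : ℝ) :
    bracket w₂ f x = w₂ x * deriv f x - deriv w₂ x * f x := by
  rw [bracket, hw.conj₂, hw.conj_deriv₂]

/-- The Wronskian of the pair is identically `1`. -/
theorem wronskian (hw : IsBoundaryPair q w₁ w₂) (x : ℝ) :
    w₁ x * deriv w₂ x - deriv w₁ x * w₂ x = 1 := by
  rw [← hw.bracket₁]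
  refine tendsto_nhds_unique ?_ hw.tendsto_top
  refine tendsto_const_nhds.congr fun t => ?_
  have h := InMaxDomain.bracket_sub_bracket hw.mem₁ hw.mem₂ x t
  rw [intervalIntegral.integral_zero_ae] at h
  · exact (sub_eq_zero.1 h).symm
  · filter_upwards [hw.sol₁.ae_tau_eq_zero, hw.sol₂.ae_tau_eq_zero] with s h1 h2 _
    simp [h1, h2]

/-- Variation of parameters. -/
theorem isACTwo_variation (hw : IsBoundaryPair q w₁ w₂) {A B k : ℝ → ℂ} (hA : ACLoc A)
    (hB : ACLoc B) (hA' : ∀ᵐ x, HasDerivAt A (w₂ x * k x) x)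
    (hB' : ∀ᵐ x, HasDerivAt B (-(w₁ x * k x)) x) :
    IsACTwo (fun x => A x * w₁ x + B x * w₂ x) ∧
      (deriv fun x => A x * w₁ x + B x * w₂ x) =
        (fun x => A x * deriv w₁ x + B x * deriv w₂ x) ∧
      tau q (fun x => A x * w₁ x + B x * w₂ x) =ᵐ[volume] k := by
  have h := IsACTwo.of_ae ((hA.mul hw.sol₁.1.ac).add (hB.mul hw.sol₂.1.ac))
    ((hA.mul hw.sol₁.1.ac_deriv).add (hB.mul hw.sol₂.1.ac_deriv)) (by
      filter_upwards [hA', hB'] with x h1 h2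
      refine ((h1.mul (hw.sol₁.1.hasDerivAt x)).add
        (h2.mul (hw.sol₂.1.hasDerivAt x))).congr_deriv ?_
      ring)
  refine ⟨h.1, h.2, ?_⟩
  filter_upwards [hA', hB', hw.sol₁.1.ae_hasDerivAt_deriv q, hw.sol₂.1.ae_hasDerivAt_deriv q,
    hw.sol₁.ae_tau_eq_zero, hw.sol₂.ae_tau_eq_zero] with x h1 h2 h3 h4 h5 h6
  have hd : deriv (fun x => A x * deriv w₁ x + B x * deriv w₂ x) x = _ :=
    ((h1.mul h3).add (h2.mul h4)).deriv
  rw [tau, h.2, hd, h5, h6]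
  linear_combination k x * hw.wronskian x

end IsBoundaryPair

/-- The solution of `τ_q u = k` obtained by variation of parameters. -/
noncomputable def variation (w₁ w₂ k : ℝ → ℂ) (c : ℝ) (a b : ℂ) (x : ℝ) : ℂ :=
  (a + ∫ t in c..x, w₂ t * k t) * w₁ x + (b - ∫ t in c..x, w₁ t * k t) * w₂ x

namespace IsBoundaryPair

variable {q : ℝ → ℝ} {w₁ w₂ k : ℝ → ℂ}

theorem variation_spec (hw : IsBoundaryPair q w₁ w₂) (hk : LocallyIntegrable k volume) (c : ℝ)
    (a b : ℂ) : IsACTwo (variation w₁ w₂ k c a b) ∧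
      (deriv (variation w₁ w₂ k c a b)) = (fun x => (a + ∫ t in c..x, w₂ t * k t) * deriv w₁ x +
        (b - ∫ t in c..x, w₁ t * k t) * deriv w₂ x) ∧
      tau q (variation w₁ w₂ k c a b) =ᵐ[volume] k := by
  have h1 := hk.continuous_mul' hw.sol₁.1.continuous
  have h2 := hk.continuous_mul' hw.sol₂.1.continuous
  refine hw.isACTwo_variation ((ACLoc.const a).add (acLoc_integral h2 c))
    ((ACLoc.const b).sub (acLoc_integral h1 c)) ?_ ?_
  · filter_upwards [_root_.LocallyIntegrable.ae_hasDerivAt_integral h2] with x hx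
    exact (hx c).const_add a
  · filter_upwards [_root_.LocallyIntegrable.ae_hasDerivAt_integral h1] with x hx
    exact (hx c).const_sub b

/-- Because the Wronskian is 1, bracketing with `w₁` reads off the coefficient of `w₂`; bracketing
with `w₂` reads off minus the coefficient of `w₁`. -/
theorem bracket₁_variation (hw : IsBoundaryPair q w₁ w₂) (hk : LocallyIntegrable k volume)
    (c : ℝ) (a b : ℂ) (x : ℝ) :
    bracket w₁ (variation w₁ w₂ k c a b) x = b - ∫ t in c..x, w₁ t * k t := by
  rw [hw.bracket₁, (hw.variation_spec hk c a b).2.1, variation]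
  linear_combination (b - ∫ t in c..x, w₁ t * k t) * hw.wronskian x

theorem bracket₂_variation (hw : IsBoundaryPair q w₁ w₂) (hk : LocallyIntegrable k volume)
    (c : ℝ) (a b : ℂ) (x : ℝ) :
    bracket w₂ (variation w₁ w₂ k c a b) x = -(a + ∫ t in c..x, w₂ t * k t) := by
  rw [hw.bracket₂, (hw.variation_spec hk c a b).2.1, variation]
  linear_combination -(a + ∫ t in c..x, w₂ t * k t) * hw.wronskian x

end IsBoundaryPair

/-! ### Right-hand sides supported in a bounded interval -/

theorem integral_mul_self_ne_zero {w : ℝ → ℂ} (hc : Continuous w) (him : ∀ x, (w x).im = 0)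
    {a b : ℝ} (hab : a < b) (hne : ∃ c ∈ Set.Icc a b, w c ≠ 0) : ∫ t in a..b, w t * w t ≠ 0 := by
  have hw : ∀ t, w t * w t = (((w t).re * (w t).re : ℝ) : ℂ) := fun t => by
    apply Complex.ext <;> simp [him t]
  simp_rw [hw]
  rw [intervalIntegral.integral_ofReal, Complex.ofReal_ne_zero]
  obtain ⟨c, hcm, hc0⟩ := hne
  have hre : (w c).re ≠ 0 := fun h => hc0 (Complex.ext h (him c))
  exact (intervalIntegral.integral_pos (f := fun t => (w t).re * (w t).re) hab
    (by fun_prop) (fun x _ => mul_self_nonneg _) ⟨c, hcm, mul_self_pos.2 hre⟩).ne'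

section Clamp

variable {f : ℝ → ℂ} {N x : ℝ}

theorem integral_eq_zero_of_support_right (hf : ∀ t ∉ Set.Ioc (-N) N, f t = 0) (hx : x ≤ -N) :
    ∫ t in (-N)..x, f t = 0 := by
  refine intervalIntegral.integral_zero_ae (Eventually.of_forall fun t ht => hf t fun h => ?_)
  rw [Set.uIoc_of_ge hx] at ht
  exact absurd h.1 (not_lt.2 ht.2)

theorem integral_eq_of_support_left (hloc : LocallyIntegrable f volume)
    (hf : ∀ t ∉ Set.Ioc (-N) N, f t = 0) (hx : N ≤ x) :
    ∫ t in (-N)..x, f t = ∫ t in (-N)..N, f t := by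
  rw [← intervalIntegral.integral_add_adjacent_intervals
    (hloc.intervalIntegrable_real (-N) N) (hloc.intervalIntegrable_real N x), add_eq_left]
  refine intervalIntegral.integral_zero_ae (Eventually.of_forall fun t ht => hf t fun h => ?_)
  rw [Set.uIoc_of_le hx] at ht
  exact absurd h.2 (not_le.2 ht.1)

theorem exists_bound_integral_of_support (hloc : LocallyIntegrable f volume)
    (hf : ∀ t ∉ Set.Ioc (-N) N, f t = 0) : ∃ C, ∀ x, ‖∫ t in (-N)..x, f t‖ ≤ C := by
  obtain ⟨C, hC⟩ := (isCompact_Icc (a := -N) (b := N)).exists_bound_of_continuousOn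
    (acLoc_integral hloc (-N)).continuous.continuousOn
  refine ⟨max (max C 0) ‖∫ t in (-N)..N, f t‖, fun x => ?_⟩
  rcases le_total x (-N) with h | h
  · simp [integral_eq_zero_of_support_right hf h]
  rcases le_total N x with h' | h'
  · simp [integral_eq_of_support_left hloc hf h']
  · exact (hC x ⟨h, h'⟩).trans ((le_max_left _ _).trans (le_max_left _ _))

theorem integral_eq_intervalIntegral_of_support (hN : 0 ≤ N)
    (hf : ∀ t ∉ Set.Ioc (-N) N, f t = 0) : ∫ t, f t = ∫ t in (-N)..N, f t := by
  rw [intervalIntegral.integral_of_le (by linarith),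
    setIntegral_eq_integral_of_forall_compl_eq_zero fun t ht => hf t ht]

end Clamp

theorem memLp_mul_of_bound {A w : ℝ → ℂ} (hA : Continuous A) (hw : MemLp w 2 volume)
    (h : ∃ C, ∀ x, ‖A x‖ ≤ C) : MemLp (fun x => A x * w x) 2 volume := by
  obtain ⟨C, hC⟩ := h
  refine hw.of_le_mul (c := C) (hA.aestronglyMeasurable.mul hw.1) (Eventually.of_forall fun x => ?_)
  rw [norm_mul]
  exact mul_le_mul_of_nonneg_right (hC x) (norm_nonneg _)

theorem integrable_continuous_mul {g p : ℝ → ℂ} {N : ℝ} (hg : Continuous g)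
    (hp : LocallyIntegrable p volume) (hp0 : ∀ t ∉ Set.Ioc (-N) N, p t = 0) :
    Integrable (fun t => g t * p t) volume := by
  have h : IntegrableOn (fun t => g t * p t) (Set.Icc (-N) N) volume :=
    (locallyIntegrable_iff.1 (hp.continuous_mul' hg)) _ isCompact_Icc
  refine (integrableOn_iff_integrable_of_support_subset fun t ht => ?_).1 h
  by_contra hc
  exact ht (by simp [hp0 t fun h => hc (Set.Ioc_subset_Icc_self h)])

theorem memLp_indicator_continuous {g : ℝ → ℂ} (hg : Continuous g) (a b : ℝ) :
    MemLp ((Set.Ioc a b).indicator g) 2 volume := by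
  rw [memLp_indicator_iff_restrict measurableSet_Ioc]
  obtain ⟨C, hC⟩ := (isCompact_Icc (a := a) (b := b)).exists_bound_of_continuousOn hg.continuousOn
  refine MemLp.of_bound hg.aestronglyMeasurable C ?_
  filter_upwards [ae_restrict_mem measurableSet_Ioc] with x hx
  exact hC x (Set.Ioc_subset_Icc_self hx)

namespace IsBoundaryPair

variable {q : ℝ → ℝ} {w₁ w₂ k : ℝ → ℂ} {N : ℝ}

theorem continuous₁ (hw : IsBoundaryPair q w₁ w₂) : Continuous w₁ := hw.sol₁.1.continuous

theorem continuous₂ (hw : IsBoundaryPair q w₁ w₂) : Continuous w₂ := hw.sol₂.1.continuous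

theorem integral_mul_self_ne_zero₁ (hw : IsBoundaryPair q w₁ w₂) (hN : 0 < N) :
    ∫ t in (-N)..N, w₁ t * w₁ t ≠ 0 := by
  refine integral_mul_self_ne_zero hw.continuous₁ hw.real₁ (by linarith) ?_
  by_contra! h
  -- Vanishing near 0 would force the Wronskian at 0 to be 0.
  have h0 : w₁ =ᶠ[𝓝 0] fun _ => 0 := by
    filter_upwards [Icc_mem_nhds (by linarith : -N < 0) hN] with x hx using h x hx
  have h1 := hw.wronskian 0
  rw [h0.deriv_eq, h0.self_of_nhds] at h1
  simp at h1

theorem integral_mul_self_ne_zero₂ (hw : IsBoundaryPair q w₁ w₂) (hN : 0 < N) :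
    ∫ t in (-N)..N, w₂ t * w₂ t ≠ 0 := by
  refine integral_mul_self_ne_zero hw.continuous₂ hw.real₂ (by linarith) ?_
  by_contra! h
  have h0 : w₂ =ᶠ[𝓝 0] fun _ => 0 := by
    filter_upwards [Icc_mem_nhds (by linarith : -N < 0) hN] with x hx using h x hx
  have h1 := hw.wronskian 0
  rw [h0.deriv_eq, h0.self_of_nhds] at h1
  simp at h1

/-- The integrand is odd. This makes the Gram matrix of `w₁, w₂` on a symmetric interval diagonal,
so projections onto their span need no matrix inversion. -/
theorem integral_mul_eq_zero (hw : IsBoundaryPair q w₁ w₂) (N : ℝ) :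
    ∫ t in (-N)..N, w₁ t * w₂ t = 0 := by
  have h := intervalIntegral.integral_comp_neg (a := -N) (b := N) fun t => w₁ t * w₂ t
  simp only [hw.odd₁ _, hw.even₂ _, neg_mul, intervalIntegral.integral_neg, neg_neg] at h
  linear_combination -(1 / 2 : ℂ) * h

/-- Outside the support of `k` the two coefficients are constant, so they are bounded and square
integrability is inherited from `w₁` and `w₂`. -/
theorem inMaxDomain_variation (hw : IsBoundaryPair q w₁ w₂) (hk : MemLp k 2 volume)
    (hk0 : ∀ t ∉ Set.Ioc (-N) N, k t = 0) (a b : ℂ) :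
    InMaxDomain q (variation w₁ w₂ k (-N) a b) := by
  have hkl := hk.locallyIntegrable_two
  have h := hw.variation_spec hkl (-N) a b
  have l1 := hkl.continuous_mul' hw.continuous₁
  have l2 := hkl.continuous_mul' hw.continuous₂
  refine ⟨h.1, ?_, hk.ae_eq h.2.2.symm⟩
  refine MemLp.add (memLp_mul_of_bound ?_ hw.mem₁.memLp ?_)
    (memLp_mul_of_bound ?_ hw.mem₂.memLp ?_)
  · exact continuous_const.add (acLoc_integral l2 _).continuous
  · obtain ⟨C, hC⟩ := exists_bound_integral_of_support l2 (N := N)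
      fun t ht => by rw [hk0 t ht, mul_zero]
    exact ⟨‖a‖ + C, fun x => (norm_add_le _ _).trans (add_le_add_right (hC x) _)⟩
  · exact continuous_const.sub (acLoc_integral l1 _).continuous
  · obtain ⟨C, hC⟩ := exists_bound_integral_of_support l1 (N := N)
      fun t ht => by rw [hk0 t ht, mul_zero]
    exact ⟨‖b‖ + C, fun x => (norm_sub_le _ _).trans (add_le_add_right (hC x) _)⟩

/-- A compactly supported square integrable function orthogonal to `w₁` and `w₂` is in the range
of the pre-minimal operator. -/
theorem exists_compact_solution (hw : IsBoundaryPair q w₁ w₂) (hk : MemLp k 2 volume)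
    (hk0 : ∀ t ∉ Set.Ioc (-N) N, k t = 0) (h1 : ∫ t in (-N)..N, w₁ t * k t = 0)
    (h2 : ∫ t in (-N)..N, w₂ t * k t = 0) :
    ∃ y ∈ compactDomain q, tau q y =ᵐ[volume] k := by
  have hkl := hk.locallyIntegrable_two
  refine ⟨⟨_, hw.inMaxDomain_variation hk hk0 0 0⟩, ?_, (hw.variation_spec hkl (-N) 0 0).2.2⟩
  refine HasCompactSupport.intro (isCompact_Icc (a := -N) (b := N)) fun x hx => ?_
  have z1 : ∀ t ∉ Set.Ioc (-N) N, w₁ t * k t = 0 := fun t ht => by rw [hk0 t ht, mul_zero]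
  have z2 : ∀ t ∉ Set.Ioc (-N) N, w₂ t * k t = 0 := fun t ht => by rw [hk0 t ht, mul_zero]
  change variation w₁ w₂ k (-N) 0 0 x = 0
  rw [variation]
  -- Zero data at `-N` make the solution vanish on the left; to the right of `N` its coefficients
  -- are the two moments of `k`, which vanish by assumption.
  rcases le_total x (-N) with h | h
  · simp [integral_eq_zero_of_support_right z1 h, integral_eq_zero_of_support_right z2 h]
  rcases le_total N x with h' | h'
  · simp [integral_eq_of_support_left (hkl.continuous_mul' hw.continuous₁) z1 h',
      integral_eq_of_support_left (hkl.continuous_mul' hw.continuous₂) z2 h', h1, h2]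
  · exact absurd ⟨h, h'⟩ hx

end IsBoundaryPair

/-! ### Regularity of weak solutions -/

/-- Green's formula with one factor of compact support. -/
theorem integral_conj_tau_mul {q : ℝ → ℝ} {u : ℝ → ℂ} (hu : IsACTwo u)
    (hτ : MemLp (tau q u) 2 volume) {y : maxDomain q} (hy : y ∈ compactDomain q) :
    ∫ t, conj (tau q u t) * (y : ℝ → ℂ) t = ∫ t, conj (u t) * tau q y t := by
  have hy' : HasCompactSupport (y : ℝ → ℂ) := hy
  obtain ⟨N, hN⟩ : ∃ N : ℝ, tsupport (y : ℝ → ℂ) ⊆ Set.Ioc (-N) N := by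
    obtain ⟨r, hr⟩ := hy'.isCompact.isBounded.subset_closedBall 0
    refine ⟨r + 1, hr.trans fun x hx => ?_⟩
    rw [Metric.mem_closedBall, dist_zero_right, Real.norm_eq_abs, abs_le] at hx
    exact ⟨by linarith, by linarith⟩
  have hy0 : ∀ t ∉ tsupport (y : ℝ → ℂ), (y : ℝ → ℂ) t = 0 := fun t ht =>
    image_eq_zero_of_notMem_tsupport ht
  have hd0 : ∀ t ∉ tsupport (y : ℝ → ℂ), deriv (y : ℝ → ℂ) t = 0 := fun t ht => by
    by_contra h
    exact ht (support_deriv_subset h)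
  have hdd0 : ∀ t ∉ tsupport (y : ℝ → ℂ), deriv (deriv (y : ℝ → ℂ)) t = 0 := fun t ht => by
    by_contra h
    exact ht (closure_minimal support_deriv_subset (isClosed_tsupport _)
      (support_deriv_subset h))
  have hτ0 : ∀ t ∉ Set.Ioc (-N) N, tau q y t = 0 := fun t ht => by
    simp [tau, hy0 t fun h => ht (hN h), hdd0 t fun h => ht (hN h)]
  have i1 := integrable_conj_mul hτ y.2.memLp
  -- `u` need not be square integrable: `τ_q y` vanishes outside a bounded interval.
  have i2 : Integrable (fun t => conj (u t) * tau q y t) volume :=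
    integrable_continuous_mul (Complex.continuous_conj.comp hu.continuous)
    y.2.memLp_tau.locallyIntegrable_two hτ0
  rw [← sub_eq_zero, ← integral_sub i1 i2]
  refine tendsto_nhds_unique (intervalIntegral_tendsto_integral (i1.sub i2)
    tendsto_neg_atTop_atBot tendsto_id) ?_
  refine tendsto_const_nhds.congr' ?_
  filter_upwards [eventually_gt_atTop |N|] with R hR
  have hR' := abs_lt.1 hR
  have e := bracket_sub_bracket hu y.2.ac hτ.locallyIntegrable_two
    y.2.memLp_tau.locallyIntegrable_two (-R) R
  have o1 : R ∉ tsupport (y : ℝ → ℂ) := fun h => absurd (hN h).2 (by linarith)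
  have o2 : -R ∉ tsupport (y : ℝ → ℂ) := fun h => absurd (hN h).1 (by linarith)
  rw [bracket, bracket, hy0 _ o1, hy0 _ o2, hd0 _ o1, hd0 _ o2] at e
  simp only [mul_zero, sub_zero] at e
  exact e

namespace IsBoundaryPair

variable {q : ℝ → ℝ} {w₁ w₂ : ℝ → ℂ}

/-- Both `h` and `u` solve `τ_q · = k` weakly, and each admissible `p` is `τ_q y` for a compactly
supported test function `y`. -/
theorem integral_conj_mul_eq_of_weak (hw : IsBoundaryPair q w₁ w₂) {h k : L2R}
    (H : ∀ y ∈ compactDomain q, inner ℂ h (tauL2 q y) = inner ℂ k (toL2 q y))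
    {u : ℝ → ℂ} (hu : IsACTwo u) (hτ : tau q u =ᵐ[volume] k) {N : ℝ} {p : ℝ → ℂ}
    (hp : MemLp p 2 volume) (hp0 : ∀ t ∉ Set.Ioc (-N) N, p t = 0)
    (h1 : ∫ t in (-N)..N, w₁ t * p t = 0) (h2 : ∫ t in (-N)..N, w₂ t * p t = 0) :
    ∫ t, conj (h t) * p t = ∫ t, conj (u t) * p t := by
  obtain ⟨y, hy, hyp⟩ := hw.exists_compact_solution hp hp0 h1 h2
  have e := H y hy
  have hk := Lp.memLp k
  have a1 : inner ℂ h (tauL2 q y) = ∫ t, conj (h t) * p t := by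
    conv_lhs => rw [← Lp.toLp_coeFn h (Lp.memLp h)]
    refine (inner_toLp (Lp.memLp h) y.2.memLp_tau).trans (integral_congr_ae ?_)
    filter_upwards [hyp] with t ht
    rw [ht]
  have a2 : inner ℂ k (toL2 q y) = ∫ t, conj (tau q u t) * (y : ℝ → ℂ) t := by
    conv_lhs => rw [← Lp.toLp_coeFn k hk]
    refine (inner_toLp hk y.2.memLp).trans (integral_congr_ae ?_)
    filter_upwards [hτ] with t ht
    rw [ht]
  rw [a1, a2, integral_conj_tau_mul hu (hk.ae_eq hτ.symm) hy] at e
  rw [e]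
  refine integral_congr_ae ?_
  filter_upwards [hyp] with t ht
  rw [ht]

/-- On the interval `h - u` is orthogonal to everything orthogonal to `w₁` and `w₂`. Testing with
its own residual after projection onto their span shows that the residual is zero. -/
theorem exists_ae_eq_of_weak (hw : IsBoundaryPair q w₁ w₂) {h k : L2R}
    (H : ∀ y ∈ compactDomain q, inner ℂ h (tauL2 q y) = inner ℂ k (toL2 q y))
    {u : ℝ → ℂ} (hu : IsACTwo u) (hτ : tau q u =ᵐ[volume] k) {N : ℝ} (hN : 0 < N) :
    ∃ c₁ c₂ : ℂ, ∀ᵐ x, x ∈ Set.Ioc (-N) N → h x = u x + c₁ * w₁ x + c₂ * w₂ x := by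
  have hN' : -N ≤ N := by linarith
  have hh := Lp.memLp h
  have hhl := hh.locallyIntegrable_two
  set I₁ := ∫ t in (-N)..N, w₁ t * w₁ t with hI₁
  set I₂ := ∫ t in (-N)..N, w₂ t * w₂ t with hI₂
  have hI₁0 : I₁ ≠ 0 := hw.integral_mul_self_ne_zero₁ hN
  have hI₂0 : I₂ ≠ 0 := hw.integral_mul_self_ne_zero₂ hN
  have vl : LocallyIntegrable (fun t => h t - u t) volume :=
    hhl.sub hu.continuous.locallyIntegrable
  -- Coefficients of the orthogonal projection of `h - u` onto the span of `w₁, w₂`.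
  set c₁ := (∫ t in (-N)..N, w₁ t * (h t - u t)) / I₁ with hc₁
  set c₂ := (∫ t in (-N)..N, w₂ t * (h t - u t)) / I₂ with hc₂
  have k1 := hw.continuous₁
  have k2 := hw.continuous₂
  set g : ℝ → ℂ := fun x => u x + c₁ * w₁ x + c₂ * w₂ x with hg
  have hgc : Continuous g := by
    have := hu.continuous
    fun_prop
  set p : ℝ → ℂ := (Set.Ioc (-N) N).indicator fun x => h x - g x with hp
  have hp0 : ∀ t ∉ Set.Ioc (-N) N, p t = 0 := fun t ht => Set.indicator_of_notMem ht _
  have hpm : MemLp p 2 volume := by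
    have := (hh.indicator (measurableSet_Ioc (a := -N) (b := N))).sub
      (memLp_indicator_continuous hgc (-N) N)
    rwa [← Set.indicator_sub'] at this
  have key : ∀ w : ℝ → ℂ, Continuous w → ∫ t in (-N)..N, w t * p t =
      (∫ t in (-N)..N, w t * (h t - u t)) - c₁ * (∫ t in (-N)..N, w₁ t * w t)
        - c₂ * ∫ t in (-N)..N, w₂ t * w t := by
    intro w hwc
    rw [← intervalIntegral.integral_const_mul, ← intervalIntegral.integral_const_mul,
      ← intervalIntegral.integral_sub, ← intervalIntegral.integral_sub]
    · refine intervalIntegral.integral_congr_ae (Eventually.of_forall fun t ht => ?_)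
      rw [Set.uIoc_of_le hN'] at ht
      simp only [hp, Set.indicator_of_mem ht, hg]
      ring
    · exact ((vl.continuous_mul' hwc).intervalIntegrable_real _ _).sub
        ((by fun_prop : Continuous fun t => c₁ * (w₁ t * w t)).intervalIntegrable _ _)
    · exact (by fun_prop : Continuous fun t => c₂ * (w₂ t * w t)).intervalIntegrable _ _
    · exact (vl.continuous_mul' hwc).intervalIntegrable_real _ _
    · exact (by fun_prop : Continuous fun t => c₁ * (w₁ t * w t)).intervalIntegrable _ _
  have h1 : ∫ t in (-N)..N, w₁ t * p t = 0 := by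
    have h21 : ∫ t in (-N)..N, w₂ t * w₁ t = 0 := by
      simpa only [mul_comm] using hw.integral_mul_eq_zero N
    rw [key w₁ k1, h21, ← hI₁, hc₁]
    field_simp
    ring
  have h2 : ∫ t in (-N)..N, w₂ t * p t = 0 := by
    rw [key w₂ k2, hw.integral_mul_eq_zero N, ← hI₂, hc₂]
    field_simp
    ring
  have e := hw.integral_conj_mul_eq_of_weak H hu hτ hpm hp0 h1 h2
  have hpl := hpm.locallyIntegrable_two
  have i0 := integrable_conj_mul hh hpm
  have iu : Integrable (fun t => conj (u t) * p t) volume :=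
    integrable_continuous_mul (Complex.continuous_conj.comp hu.continuous) hpl hp0
  have i1 := integrable_continuous_mul k1 hpl hp0
  have i2 := integrable_continuous_mul k2 hpl hp0
  have hpp : ∫ t, conj (p t) * p t = 0 := by
    have e1 : ∫ t, w₁ t * p t = 0 := by
      rw [integral_eq_intervalIntegral_of_support hN.le fun t ht => by rw [hp0 t ht, mul_zero], h1]
    have e2 : ∫ t, w₂ t * p t = 0 := by
      rw [integral_eq_intervalIntegral_of_support hN.le fun t ht => by rw [hp0 t ht, mul_zero], h2]
    calc ∫ t, conj (p t) * p t = ∫ t, (conj (h t) * p t - conj (u t) * p t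
          - conj c₁ * (w₁ t * p t) - conj c₂ * (w₂ t * p t)) := by
          refine integral_congr_ae (Eventually.of_forall fun t => ?_)
          by_cases ht : t ∈ Set.Ioc (-N) N
          · simp only [hp, Set.indicator_of_mem ht, hg, map_sub, map_add, map_mul, hw.conj₁,
              hw.conj₂]
            ring
          · simp [hp0 t ht]
      _ = 0 := by
          have j1 : Integrable (fun t => conj (h t) * p t - conj (u t) * p t) volume := i0.sub iu
          have j2 : Integrable (fun t => conj (h t) * p t - conj (u t) * p t
              - conj c₁ * (w₁ t * p t)) volume := j1.sub (i1.const_mul _)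
          rw [integral_sub j2 (i2.const_mul _), integral_sub j1 (i1.const_mul _),
            integral_sub i0 iu, e, integral_const_mul, integral_const_mul, e1, e2]
          simp
  have hz : hpm.toLp p = 0 := by
    rw [← inner_self_eq_zero (𝕜 := ℂ), inner_toLp hpm hpm, hpp]
  have hz' : p =ᵐ[volume] 0 :=
    hpm.coeFn_toLp.symm.trans (hz ▸ Lp.coeFn_zero ..)
  refine ⟨c₁, c₂, ?_⟩
  filter_upwards [hz'] with x hx hxm
  simp only [hp, Set.indicator_of_mem hxm, Pi.zero_apply] at hx
  exact sub_eq_zero.1 hx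

/-- This is the inclusion `A* ⊆ A_max`. Locally `h` is `u` plus a combination of `w₁, w₂`; the
coefficients do not depend on the interval, and become the initial data of a single variation of
parameters. -/
theorem exists_maxDomain_of_weak (hw : IsBoundaryPair q w₁ w₂) {h k : L2R}
    (H : ∀ y ∈ compactDomain q, inner ℂ h (tauL2 q y) = inner ℂ k (toL2 q y)) :
    ∃ u : maxDomain q, toL2 q u = h ∧ tauL2 q u = k := by
  have hk := Lp.memLp k
  have hkl := hk.locallyIntegrable_two
  have hs := hw.variation_spec hkl 0 0 0
  set u := variation w₁ w₂ k 0 0 0 with hu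
  -- Half-lengths `n + 1` put `(-1, 1]`, the case `n = 0`, inside every interval, where coefficients
  -- can be compared.
  have hN : ∀ n : ℕ, (0 : ℝ) < n + 1 := fun n => by positivity
  choose c₁ c₂ hc using fun n : ℕ => hw.exists_ae_eq_of_weak H hs.1 hs.2.2 (hN n)
  have k1 := hw.continuous₁
  have k2 := hw.continuous₂
  have key : ∀ n, ∀ᵐ x, x ∈ Set.Ioc (-1 : ℝ) 1 →
      (c₁ n - c₁ 0) * w₁ x + (c₂ n - c₂ 0) * w₂ x = 0 := fun n => by
    filter_upwards [hc n, hc 0] with x hx h0 hxm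
    have hn : (1 : ℝ) ≤ n + 1 := by simp
    have e1 := hx ⟨by linarith [hxm.1], by linarith [hxm.2]⟩
    have e2 := h0 (by simpa using hxm)
    linear_combination e2 - e1
  have hcc : ∀ n, c₁ n = c₁ 0 ∧ c₂ n = c₂ 0 := fun n => by
    -- Integrating the linear relation against `w₁` and then `w₂` isolates each coefficient by
    -- orthogonality.
    have hint : ∀ w : ℝ → ℂ, Continuous w → (c₁ n - c₁ 0) * (∫ t in (-1 : ℝ)..1, w₁ t * w t) +
        (c₂ n - c₂ 0) * (∫ t in (-1 : ℝ)..1, w₂ t * w t) = 0 := fun w hwc => by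
      rw [← intervalIntegral.integral_const_mul, ← intervalIntegral.integral_const_mul,
        ← intervalIntegral.integral_add]
      · refine intervalIntegral.integral_zero_ae ?_
        filter_upwards [key n] with x hx hxm
        rw [Set.uIoc_of_le (by norm_num)] at hxm
        linear_combination w x * hx hxm
      · exact Continuous.intervalIntegrable (by fun_prop) _ _
      · exact Continuous.intervalIntegrable (by fun_prop) _ _
    have o1 := hint w₁ k1
    have o2 := hint w₂ k2
    have h21 : ∫ t in (-1 : ℝ)..1, w₂ t * w₁ t = 0 := by
      simpa only [mul_comm] using hw.integral_mul_eq_zero 1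
    rw [h21, mul_zero, add_zero] at o1
    rw [hw.integral_mul_eq_zero 1, mul_zero, zero_add] at o2
    exact ⟨sub_eq_zero.1 ((mul_eq_zero.1 o1).resolve_right
      (hw.integral_mul_self_ne_zero₁ one_pos)), sub_eq_zero.1 ((mul_eq_zero.1 o2).resolve_right
      (hw.integral_mul_self_ne_zero₂ one_pos))⟩
  have hf := hw.variation_spec hkl 0 (c₁ 0) (c₂ 0)
  have hae : variation w₁ w₂ k 0 (c₁ 0) (c₂ 0) =ᵐ[volume] h := by
    filter_upwards [ae_all_iff.2 hc] with x hx
    obtain ⟨n, hn⟩ := exists_nat_ge |x|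
    have hx' := abs_le.1 hn
    rw [hx n ⟨by linarith [hx'.1], by linarith [hx'.2]⟩, (hcc n).1, (hcc n).2, hu, variation,
      variation]
    ring
  have hm : InMaxDomain q (variation w₁ w₂ k 0 (c₁ 0) (c₂ 0)) :=
    ⟨hf.1, (Lp.memLp h).ae_eq hae.symm, hk.ae_eq hf.2.2.symm⟩
  exact ⟨⟨_, hm⟩, Lp.ext (hm.memLp.coeFn_toLp.trans hae),
    Lp.ext (hm.memLp_tau.coeFn_toLp.trans hf.2.2)⟩

end IsBoundaryPair

/-! ### Adjoints of bi-extensions in terms of brackets -/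

theorem preminOp_domain_mem {q : ℝ → ℝ} {y : maxDomain q} (hy : y ∈ compactDomain q) :
    toL2 q y ∈ (preminOp q).domain :=
  ⟨Submodule.mem_map_of_mem hy, LinearMap.mem_range_self _ y⟩

theorem preminOp_apply {q : ℝ → ℝ} {y : maxDomain q} (hy : y ∈ compactDomain q) :
    preminOp q ⟨toL2 q y, preminOp_domain_mem hy⟩ = tauL2 q y :=
  (LinearPMap.domRestrict_apply (y := ⟨toL2 q y, LinearMap.mem_range_self _ y⟩) rfl).trans
    (maxOp_apply q y)

namespace IsBoundaryPair

variable {q : ℝ → ℝ} {w₁ w₂ : ℝ → ℂ}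

/-- If `k` is orthogonal to the domain, then `h = 0` is a weak solution of `τ_q h = k`, so `k = τ_q
0 = 0`. -/
theorem dense_preminOp_domain (hw : IsBoundaryPair q w₁ w₂) :
    Dense ((preminOp q).domain : Set L2R) := by
  rw [Submodule.dense_iff_topologicalClosure_eq_top, Submodule.topologicalClosure_eq_top_iff,
    Submodule.eq_bot_iff]
  intro k hk
  rw [Submodule.mem_orthogonal'] at hk
  obtain ⟨u, h0, hu⟩ := hw.exists_maxDomain_of_weak (h := 0) (k := k) fun y hy => by
    rw [inner_zero_left, hk _ (preminOp_domain_mem hy)]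
  have : u = 0 := toL2_injective q (h0.trans (map_zero _).symm)
  rw [← hu, this, map_zero]

/-- The adjoint of an extension of the pre-minimal operator is a restriction of the maximal
operator. -/
theorem exists_of_mem_adjoint (hw : IsBoundaryPair q w₁ w₂) {S : L2R →ₗ.[ℂ] L2R}
    (hS : preminOp q ≤ S) (x : (S†).domain) :
    ∃ u : maxDomain q, toL2 q u = x ∧ tauL2 q u = S† x := by
  have hd : Dense (S.domain : Set L2R) := hw.dense_preminOp_domain.mono hS.1
  refine hw.exists_maxDomain_of_weak fun y hy => ?_
  have hm := hS.1 (preminOp_domain_mem hy)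
  have e : S ⟨toL2 q y, hm⟩ = tauL2 q y :=
    (hS.2 (x := ⟨toL2 q y, preminOp_domain_mem hy⟩) (y := ⟨toL2 q y, hm⟩) rfl).symm.trans
      (preminOp_apply hy)
  rw [← e]
  exact (LinearPMap.adjoint_isFormalAdjoint hd x ⟨toL2 q y, hm⟩).symm

theorem biExtension_apply (hw : IsBoundaryPair q w₁ w₂) {T : L2R →ₗ.[ℂ] L2R}
    (hT : IsBiExtension (minOp q) T) {f : maxDomain q} (hf : toL2 q f ∈ T.domain) :
    T ⟨toL2 q f, hf⟩ = tauL2 q f := by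
  obtain ⟨u, h1, h2⟩ := hw.exists_of_mem_adjoint (LinearPMap.le_closure _)
    ⟨toL2 q f, hT.le_adjoint.1 hf⟩
  obtain rfl := toL2_injective q h1
  exact (hT.le_adjoint.2 (x := ⟨toL2 q u, hf⟩) (y := ⟨toL2 q u, hT.le_adjoint.1 hf⟩) rfl).trans
    h2.symm

theorem exists_of_mem_biExtension (hw : IsBoundaryPair q w₁ w₂) {T : L2R →ₗ.[ℂ] L2R}
    (hT : IsBiExtension (minOp q) T) {x : L2R} (hx : x ∈ T.domain) :
    ∃ f : maxDomain q, toL2 q f = x := by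
  obtain ⟨u, h1, -⟩ := hw.exists_of_mem_adjoint (LinearPMap.le_closure _)
    ⟨x, hT.le_adjoint.1 hx⟩
  exact ⟨u, h1⟩

/-- `T` and `T†` both act as `τ_q`, so the adjoint relation is the vanishing of the boundary term in
Green's formula. -/
theorem toL2_mem_adjoint_iff (hw : IsBoundaryPair q w₁ w₂) {T : L2R →ₗ.[ℂ] L2R}
    (hT : IsBiExtension (minOp q) T) (g : maxDomain q) :
    toL2 q g ∈ (T†).domain ↔
      ∀ f : maxDomain q, toL2 q f ∈ T.domain → bracketBot g f = bracketTop g f := by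
  have hle : preminOp q ≤ T := (LinearPMap.le_closure _).trans hT.le
  constructor
  · intro hg f hf
    obtain ⟨u, h1, h2⟩ := hw.exists_of_mem_adjoint hle ⟨toL2 q g, hg⟩
    obtain rfl := toL2_injective q h1
    have e := LinearPMap.adjoint_isFormalAdjoint (hw.dense_preminOp_domain.mono hle.1)
      ⟨toL2 q u, hg⟩ ⟨toL2 q f, hf⟩
    rw [← h2, hw.biExtension_apply hT hf, ← sub_eq_zero, inner_tauL2_sub] at e
    exact (sub_eq_zero.1 e).symm
  · intro h
    refine LinearPMap.mem_adjoint_domain_of_exists _ ⟨tauL2 q g, fun x => ?_⟩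
    obtain ⟨x, hx⟩ := x
    obtain ⟨f, rfl⟩ := hw.exists_of_mem_biExtension hT hx
    rw [hw.biExtension_apply hT hx, ← sub_eq_zero, inner_tauL2_sub, h f hx, sub_self]

/-! ### The boundary form and the boundary map -/

/-- The Plücker identity for 2×2 determinants, with the Wronskian of `w₁, w₂` equal to 1. -/
theorem bracket_eq (hw : IsBoundaryPair q w₁ w₂) (f g : ℝ → ℂ) (x : ℝ) :
    bracket f g x = conj (bracket w₁ f x) * bracket w₂ g x -
      conj (bracket w₂ f x) * bracket w₁ g x := by
  simp only [map_sub, map_mul, hw.conj₁, hw.conj₂, hw.conj_deriv₁, hw.conj_deriv₂, bracket]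
  linear_combination -(conj (f x) * deriv g x - conj (deriv f x) * g x) * hw.wronskian x

theorem bracketTop_eq (hw : IsBoundaryPair q w₁ w₂) (f g : maxDomain q) :
    bracketTop f g = conj (bracketTop w₁ f) * bracketTop w₂ g -
      conj (bracketTop w₂ f) * bracketTop w₁ g := by
  refine tendsto_nhds_unique (f.2.tendsto_bracketTop g.2) ?_
  have hc := Complex.continuous_conj
  refine Tendsto.congr (fun x => (hw.bracket_eq f g x).symm) ?_
  exact (((hc.tendsto _).comp (hw.mem₁.tendsto_bracketTop f.2)).mul
    (hw.mem₂.tendsto_bracketTop g.2)).sub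
    (((hc.tendsto _).comp (hw.mem₂.tendsto_bracketTop f.2)).mul
    (hw.mem₁.tendsto_bracketTop g.2))

theorem bracketBot_eq (hw : IsBoundaryPair q w₁ w₂) (f g : maxDomain q) :
    bracketBot f g = conj (bracketBot w₁ f) * bracketBot w₂ g -
      conj (bracketBot w₂ f) * bracketBot w₁ g := by
  refine tendsto_nhds_unique (f.2.tendsto_bracketBot g.2) ?_
  have hc := Complex.continuous_conj
  refine Tendsto.congr (fun x => (hw.bracket_eq f g x).symm) ?_
  exact (((hc.tendsto _).comp (hw.mem₁.tendsto_bracketBot f.2)).mul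
    (hw.mem₂.tendsto_bracketBot g.2)).sub
    (((hc.tendsto _).comp (hw.mem₂.tendsto_bracketBot f.2)).mul
    (hw.mem₁.tendsto_bracketBot g.2))

/-- The boundary map is onto `ℂ⁴`. -/
theorem exists_boundary_values (hw : IsBoundaryPair q w₁ w₂) (a₁ a₂ b₁ b₂ : ℂ) :
    ∃ y : maxDomain q, bracketBot w₁ y = a₁ ∧ bracketBot w₂ y = a₂ ∧
      bracketTop w₁ y = b₁ ∧ bracketTop w₂ y = b₂ := by
  set I₁ := ∫ t in (-1 : ℝ)..1, w₁ t * w₁ t with hI₁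
  set I₂ := ∫ t in (-1 : ℝ)..1, w₂ t * w₂ t with hI₂
  have hI₁0 : I₁ ≠ 0 := hw.integral_mul_self_ne_zero₁ one_pos
  have hI₂0 : I₂ ≠ 0 := hw.integral_mul_self_ne_zero₂ one_pos
  have k1 := hw.continuous₁
  have k2 := hw.continuous₂
  -- By orthogonality this source has moments `a₁ - b₁` and `a₂ - b₂` against `w₁` and `w₂`, the
  -- required drops from the left values to the right ones.
  set g : ℝ → ℂ := fun x => (a₁ - b₁) / I₁ * w₁ x + (a₂ - b₂) / I₂ * w₂ x with hg
  have hgc : Continuous g := by fun_prop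
  set k : ℝ → ℂ := (Set.Ioc (-1) 1).indicator g with hk
  have hk0 : ∀ t ∉ Set.Ioc (-1) 1, k t = 0 := fun t ht => Set.indicator_of_notMem ht _
  have hkm : MemLp k 2 volume := memLp_indicator_continuous hgc _ _
  have hkl := hkm.locallyIntegrable_two
  have key : ∀ w : ℝ → ℂ, Continuous w → ∫ t in (-1 : ℝ)..1, w t * k t =
      (a₁ - b₁) / I₁ * (∫ t in (-1 : ℝ)..1, w₁ t * w t) +
        (a₂ - b₂) / I₂ * ∫ t in (-1 : ℝ)..1, w₂ t * w t := by
    intro w hwc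
    rw [← intervalIntegral.integral_const_mul, ← intervalIntegral.integral_const_mul,
      ← intervalIntegral.integral_add]
    · refine intervalIntegral.integral_congr_ae (Eventually.of_forall fun t ht => ?_)
      rw [Set.uIoc_of_le (by norm_num)] at ht
      simp only [hk, Set.indicator_of_mem ht, hg]
      ring
    · exact Continuous.intervalIntegrable (by fun_prop) _ _
    · exact Continuous.intervalIntegrable (by fun_prop) _ _
  have h1 : ∫ t in (-1 : ℝ)..1, w₁ t * k t = a₁ - b₁ := by
    have h21 : ∫ t in (-1 : ℝ)..1, w₂ t * w₁ t = 0 := by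
      simpa only [mul_comm] using hw.integral_mul_eq_zero 1
    rw [key w₁ k1, h21, ← hI₁]
    field_simp
    ring
  have h2 : ∫ t in (-1 : ℝ)..1, w₂ t * k t = a₂ - b₂ := by
    rw [key w₂ k2, hw.integral_mul_eq_zero 1, ← hI₂]
    field_simp
    ring
  have z1 : ∀ t ∉ Set.Ioc (-1 : ℝ) 1, w₁ t * k t = 0 := fun t ht => by rw [hk0 t ht, mul_zero]
  have z2 : ∀ t ∉ Set.Ioc (-1 : ℝ) 1, w₂ t * k t = 0 := fun t ht => by rw [hk0 t ht, mul_zero]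
  -- The data are crossed because `[w₁,·]` is the coefficient of `w₂` and `[w₂,·]` is minus that of
  -- `w₁`.
  refine ⟨⟨variation w₁ w₂ k (-1) (-a₂) a₁, hw.inMaxDomain_variation hkm hk0 _ _⟩, ?_, ?_, ?_, ?_⟩
  · refine (tendsto_const_nhds.congr' ?_).limUnder_eq
    filter_upwards [eventually_le_atBot (-1 : ℝ)] with x hx
    rw [hw.bracket₁_variation hkl, integral_eq_zero_of_support_right z1 hx, sub_zero]
  · refine (tendsto_const_nhds.congr' ?_).limUnder_eq
    filter_upwards [eventually_le_atBot (-1 : ℝ)] with x hx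
    rw [hw.bracket₂_variation hkl, integral_eq_zero_of_support_right z2 hx, add_zero, neg_neg]
  · refine (tendsto_const_nhds.congr' ?_).limUnder_eq
    filter_upwards [eventually_ge_atTop (1 : ℝ)] with x hx
    rw [hw.bracket₁_variation hkl,
      integral_eq_of_support_left (hkl.continuous_mul' k1) z1 hx, h1]
    ring
  · refine (tendsto_const_nhds.congr' ?_).limUnder_eq
    filter_upwards [eventually_ge_atTop (1 : ℝ)] with x hx
    rw [hw.bracket₂_variation hkl,
      integral_eq_of_support_left (hkl.continuous_mul' k2) z2 hx, h2]
    ring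

end IsBoundaryPair

/-! ### Reflection and the Krein space adjoint -/

theorem ACLoc.comp_neg {f : ℝ → ℂ} (hf : ACLoc f) : ACLoc fun x => f (-x) := by
  intro a b
  rw [absolutelyContinuousOnInterval_iff]
  intro ε hε
  obtain ⟨δ, hδ, h⟩ := (absolutelyContinuousOnInterval_iff f (-a) (-b)).1 (hf (-a) (-b)) ε hε
  refine ⟨δ, hδ, fun E hE hlen => ?_⟩
  refine h (E.1, fun i => (-(E.2 i).1, -(E.2 i).2)) ⟨fun i hi => ?_, fun i hi j hj hij => ?_⟩ ?_
  · have h1 := hE.1 i hi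
    simp only [Set.mem_uIcc] at h1 ⊢
    constructor
    · rcases h1.1 with h | h
      · exact Or.inr ⟨neg_le_neg h.2, neg_le_neg h.1⟩
      · exact Or.inl ⟨neg_le_neg h.2, neg_le_neg h.1⟩
    · rcases h1.2 with h | h
      · exact Or.inr ⟨neg_le_neg h.2, neg_le_neg h.1⟩
      · exact Or.inl ⟨neg_le_neg h.2, neg_le_neg h.1⟩
  · have h1 := hE.2 hi hj hij
    -- Reflection turns `Ioc` into `Ico`, so disjointness is transferred through its endpoint
    -- criterion, which is symmetric under negation.
    simp only [Function.onFun, Set.uIoc, Set.Ioc_disjoint_Ioc] at h1 ⊢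
    simpa only [max_neg_neg, min_neg_neg, neg_le_neg_iff] using h1
  · simpa only [dist_neg_neg] using hlen

theorem deriv_reflect (y : ℝ → ℂ) : deriv (fun x => y (-x)) = fun x => -deriv y (-x) :=
  funext fun x => _root_.deriv_comp_neg y x

theorem deriv_deriv_reflect (y : ℝ → ℂ) (x : ℝ) :
    deriv (deriv fun x => y (-x)) x = deriv (deriv y) (-x) := by
  rw [deriv_reflect, deriv.fun_neg, _root_.deriv_comp_neg (deriv y), neg_neg]

theorem IsACTwo.reflect {y : ℝ → ℂ} (hy : IsACTwo y) : IsACTwo fun x => y (-x) where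
  diff := hy.diff.comp differentiable_neg
  ac := hy.ac.comp_neg
  ac_deriv := by
    rw [deriv_reflect]
    exact fun a b => (hy.ac_deriv.comp_neg a b).neg

theorem tau_reflect {q : ℝ → ℝ} (hq : ∀ x, q x = q (-x)) (y : ℝ → ℂ) (x : ℝ) :
    tau q (fun x => y (-x)) x = tau q y (-x) := by
  rw [tau, deriv_deriv_reflect, hq x, tau]

theorem InMaxDomain.reflect {q : ℝ → ℝ} (hq : ∀ x, q x = q (-x)) {y : ℝ → ℂ}
    (hy : InMaxDomain q y) : InMaxDomain q fun x => y (-x) where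
  ac := hy.ac.reflect
  memLp := hy.memLp.comp_measurePreserving (Measure.measurePreserving_neg volume)
  memLp_tau := by
    rw [funext (tau_reflect hq y)]
    exact hy.memLp_tau.comp_measurePreserving (Measure.measurePreserving_neg volume)

/-- The parity operator on the maximal domain of an even potential. -/
def reflect {q : ℝ → ℝ} (hq : ∀ x, q x = q (-x)) (y : maxDomain q) : maxDomain q :=
  ⟨fun x => (y : ℝ → ℂ) (-x), y.2.reflect hq⟩

theorem parity_parity (f : L2R) : parity (parity f) = f := by
  rw [← Lp.toLp_coeFn f (Lp.memLp f)]
  refine (MemLp.toLp_congr (((Lp.memLp f).comp_measurePreserving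
    (Measure.measurePreserving_neg volume)).comp_measurePreserving
    (Measure.measurePreserving_neg volume)) (Lp.memLp f) ?_)
  exact Eventually.of_forall fun x => by simp

theorem kreinAdjoint_domain_eq (T : L2R →ₗ.[ℂ] L2R) :
    ((kreinAdjoint T).domain : Set L2R) = parity '' ((T†).domain : Set L2R) := by
  ext h
  constructor
  · exact fun hh => ⟨parity h, hh, parity_parity h⟩
  · rintro ⟨g, hg, rfl⟩
    change parity (parity g) ∈ (T†).domain
    rwa [parity_parity]

namespace IsBoundaryPair

variable {q : ℝ → ℝ} {w₁ w₂ : ℝ → ℂ}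

/-- Reflecting both entries reverses the sign of the bracket; the oddness of `w₁` restores it, while
for the even `w₂` the sign remains. -/
theorem bracket₁_reflect (hw : IsBoundaryPair q w₁ w₂) (f : ℝ → ℂ) (x : ℝ) :
    bracket w₁ (fun t => f (-t)) x = bracket w₁ f (-x) := by
  have hd : deriv w₁ (-x) = deriv w₁ x := by
    have h := congrFun (deriv_reflect w₁) x
    rw [show (fun t => w₁ (-t)) = fun t => -w₁ t from funext hw.odd₁, deriv.fun_neg] at h
    exact (neg_inj.1 h).symm
  rw [hw.bracket₁, hw.bracket₁, deriv_reflect, hd, hw.odd₁]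
  ring

theorem bracket₂_reflect (hw : IsBoundaryPair q w₁ w₂) (f : ℝ → ℂ) (x : ℝ) :
    bracket w₂ (fun t => f (-t)) x = -bracket w₂ f (-x) := by
  have hd : deriv w₂ (-x) = -deriv w₂ x := by
    have h := congrFun (deriv_reflect w₂) x
    rw [show (fun t => w₂ (-t)) = w₂ from funext hw.even₂] at h
    rw [h, neg_neg]
  rw [hw.bracket₂, hw.bracket₂, deriv_reflect, hd, hw.even₂]
  ring

theorem bracket_limits_reflect (hw : IsBoundaryPair q w₁ w₂) (hq : ∀ x, q x = q (-x))
    (f : maxDomain q) :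
    bracketBot w₁ (reflect hq f) = bracketTop w₁ f ∧
    bracketBot w₂ (reflect hq f) = -bracketTop w₂ f ∧
    bracketTop w₁ (reflect hq f) = bracketBot w₁ f ∧
    bracketTop w₂ (reflect hq f) = -bracketBot w₂ f := by
  have e1 : ∀ x, bracket w₁ f (-x) = bracket w₁ (reflect hq f) x :=
    fun x => (hw.bracket₁_reflect f x).symm
  have e2 : ∀ x, -bracket w₂ f (-x) = bracket w₂ (reflect hq f) x :=
    fun x => (hw.bracket₂_reflect f x).symm
  have t1 := hw.mem₁.tendsto_bracketTop f.2
  have t2 := hw.mem₂.tendsto_bracketTop f.2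
  have b1 := hw.mem₁.tendsto_bracketBot f.2
  have b2 := hw.mem₂.tendsto_bracketBot f.2
  exact ⟨((t1.comp tendsto_neg_atBot_atTop).congr e1).limUnder_eq,
    ((t2.comp tendsto_neg_atBot_atTop).neg.congr e2).limUnder_eq,
    ((b1.comp tendsto_neg_atTop_atBot).congr e1).limUnder_eq,
    ((b2.comp tendsto_neg_atTop_atBot).neg.congr e2).limUnder_eq⟩

end IsBoundaryPair

/-! ### Annihilators of boundary conditions -/

/-- The annihilator, for the symplectic boundary form on `ℂ⁴`, of a one-dimensional space of
boundary values. -/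
theorem forall_boundary_form_eq_iff {X : Type*} {u₁ u₂ v₁ v₂ : X → ℂ}
    (hsurj : ∀ a₁ a₂ b₁ b₂ : ℂ, ∃ x, u₁ x = a₁ ∧ u₂ x = a₂ ∧ v₁ x = b₁ ∧ v₂ x = b₂) (g : X)
    {α β γ δ a₁ b₁ c d : ℂ} (hab : ‖a₁‖ + ‖b₁‖ ≠ 0)
    (hcd : ![c, d] = -(!![conj δ, -conj γ; -conj β, conj α] *ᵥ ![conj a₁, conj b₁])) :
    (∀ f, a₁ * u₁ f + b₁ * u₂ f = 0 ∧ !![α, β; γ, δ] *ᵥ ![u₁ f, u₂ f] = ![v₁ f, v₂ f] →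
      conj (u₁ g) * u₂ f - conj (u₂ g) * u₁ f = conj (v₁ g) * v₂ f - conj (v₂ g) * v₁ f) ↔
    conj a₁ * u₁ g + conj b₁ * u₂ g + c * v₁ g + d * v₂ g = 0 := by
  have hc : c = -(conj δ * conj a₁ - conj γ * conj b₁) := by
    have := congrFun hcd 0
    simp at this
    linear_combination this
  have hd : d = -(-conj β * conj a₁ + conj α * conj b₁) := by
    have := congrFun hcd 1
    simp at this
    linear_combination this
  have hmat : ∀ f, !![α, β; γ, δ] *ᵥ ![u₁ f, u₂ f] = ![v₁ f, v₂ f] ↔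
      α * u₁ f + β * u₂ f = v₁ f ∧ γ * u₁ f + δ * u₂ f = v₂ f := fun f => by
    rw [funext_iff, Fin.forall_fin_two]
    simp [Matrix.mulVec, dotProduct, Fin.sum_univ_two]
  simp only [hmat]
  -- Conjugated, the equation is linear in the conjugate boundary values of `g`, as is the form.
  have hconj : conj a₁ * u₁ g + conj b₁ * u₂ g + c * v₁ g + d * v₂ g = 0 ↔
      a₁ * conj (u₁ g) + b₁ * conj (u₂ g) - (δ * a₁ - γ * b₁) * conj (v₁ g)
        - (-β * a₁ + α * b₁) * conj (v₂ g) = 0 := by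
    rw [← map_eq_zero (starRingEnd ℂ), hc, hd]
    simp only [map_add, map_sub, map_mul, map_neg, Complex.conj_conj]
    constructor <;> intro h <;> linear_combination h
  rw [hconj]
  constructor
  · intro h
    -- One test vector suffices: the generator `(b₁, -a₁)` of the kernel of `(a₁, b₁)`, followed by
    -- its image under the matrix.
    obtain ⟨f, h1, h2, h3, h4⟩ := hsurj b₁ (-a₁) (α * b₁ - β * a₁) (γ * b₁ - δ * a₁)
    have e := h f ⟨by rw [h1, h2]; ring, by rw [h1, h2, h3]; ring, by rw [h1, h2, h4]; ring⟩
    rw [h1, h2, h3, h4] at e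
    linear_combination -e
  · rintro h f ⟨h0, h1, h2⟩
    -- Since `(a₁, b₁) ≠ 0`, every admissible `f` has boundary values that are a multiple of that
    -- generator.
    obtain ⟨t, ht1, ht2⟩ : ∃ t, u₁ f = t * b₁ ∧ u₂ f = -(t * a₁) := by
      by_cases ha : a₁ = 0
      · have hb : b₁ ≠ 0 := fun hb => hab (by simp [ha, hb])
        rw [ha, zero_mul, zero_add] at h0
        exact ⟨u₁ f / b₁, by field_simp, by
          rw [ha, (mul_eq_zero.1 h0).resolve_left hb]; ring⟩
      · refine ⟨-(u₂ f) / a₁, ?_, by field_simp⟩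
        field_simp
        linear_combination h0
    rw [← h1, ← h2, ht1, ht2]
    linear_combination -t * h

/-- The domains of the adjoint and of the Krein space adjoint, from the annihilator of the
boundary values of the domain. -/
theorem adjoint_domains {q : ℝ → ℝ} (hq_even : ∀ x, q x = q (-x)) {w₁ w₂ : ℝ → ℂ}
    (hw : IsBoundaryPair q w₁ w₂) {T : L2R →ₗ.[ℂ] L2R} (hT : IsBiExtension (minOp q) T)
    {s : Set (maxDomain q)} (hs : (T.domain : Set L2R) = toL2 q '' s) {a b c d : ℂ}
    (h : ∀ g : maxDomain q, (∀ f ∈ s, bracketBot g f = bracketTop g f) ↔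
      a * bracketBot w₁ g + b * bracketBot w₂ g + c * bracketTop w₁ g + d * bracketTop w₂ g = 0) :
    ((T†).domain : Set L2R) = toL2 q '' {g | a * bracketBot w₁ g + b * bracketBot w₂ g +
        c * bracketTop w₁ g + d * bracketTop w₂ g = 0} ∧
      ((kreinAdjoint T).domain : Set L2R) = parity '' ((T†).domain : Set L2R) ∧
      ((kreinAdjoint T).domain : Set L2R) = toL2 q '' {g | a * bracketTop w₁ g -
        b * bracketTop w₂ g + c * bracketBot w₁ g - d * bracketBot w₂ g = 0} := by
  have hmem : ∀ f, toL2 q f ∈ T.domain ↔ f ∈ s := fun f => by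
    rw [← SetLike.mem_coe, hs, (toL2_injective q).mem_set_image]
  have key : ((T†).domain : Set L2R) = toL2 q '' {g | a * bracketBot w₁ g + b * bracketBot w₂ g +
      c * bracketTop w₁ g + d * bracketTop w₂ g = 0} := by
    ext x
    constructor
    · intro hx
      obtain ⟨g, rfl, -⟩ := hw.exists_of_mem_adjoint ((LinearPMap.le_closure _).trans hT.le) ⟨x, hx⟩
      exact ⟨g, (h g).1 fun f hf => (hw.toL2_mem_adjoint_iff hT g).1 hx f ((hmem f).2 hf), rfl⟩
    · rintro ⟨g, hg, rfl⟩
      exact (hw.toL2_mem_adjoint_iff hT g).2 fun f hf => (h g).2 hg f ((hmem f).1 hf)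
  refine ⟨key, kreinAdjoint_domain_eq T, ?_⟩
  rw [kreinAdjoint_domain_eq, key, ← Set.image_comp]
  ext x
  constructor
  · rintro ⟨g, hg, rfl⟩
    obtain ⟨e1, e2, e3, e4⟩ := hw.bracket_limits_reflect hq_even g
    refine ⟨reflect hq_even g, ?_, rfl⟩
    rw [Set.mem_ofPred_eq] at hg ⊢
    rw [e1, e2, e3, e4]
    linear_combination hg
  · rintro ⟨g, hg, rfl⟩
    obtain ⟨e1, e2, e3, e4⟩ := hw.bracket_limits_reflect hq_even g
    -- Parity is an involution, so the preimage is the reflection again.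
    refine ⟨reflect hq_even g, ?_, ?_⟩
    · rw [Set.mem_ofPred_eq] at hg ⊢
      rw [e1, e2, e3, e4]
      linear_combination hg
    · exact parity_parity (toL2 q g)

end PTSymm

/-! ### The two types of boundary conditions -/

theorem mainTheorem11
    (q : ℝ → ℝ) (hq : LocallyIntegrable q volume) (hq_even : ∀ x, q x = q (-x))
    (htop : LimitCircleAtTop q) (hbot : LimitCircleAtBot q)
    (w₁ w₂ : ℝ → ℂ) (hw : IsBoundaryPair q w₁ w₂)
    (T : L2R →ₗ.[ℂ] L2R) (hT : IsBiExtension (minOp q) T)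
    (α₁ α₂ β₁ β₂ : maxDomain q → ℂ)
    (hα₁ : ∀ f, α₁ f = bracketBot w₁ f) (hα₂ : ∀ f, α₂ f = bracketBot w₂ f)
    (hβ₁ : ∀ f, β₁ f = bracketTop w₁ f) (hβ₂ : ∀ f, β₂ f = bracketTop w₂ f)
    (α β γ δ : ℂ) :
    (∀ a₁ b₁ : ℂ, ‖a₁‖ + ‖b₁‖ ≠ 0 →
      (T.domain : Set L2R) = toL2 q '' {f | a₁ * α₁ f + b₁ * α₂ f = 0 ∧
        !![α, β; γ, δ] *ᵥ ![α₁ f, α₂ f] = ![β₁ f, β₂ f]} →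
      ∀ a b c d : ℂ, a = conj a₁ → b = conj b₁ →
        ![c, d] = -(!![conj δ, -conj γ; -conj β, conj α] *ᵥ ![conj a₁, conj b₁]) →
        ((T†).domain : Set L2R) =
            toL2 q '' {g | a * α₁ g + b * α₂ g + c * β₁ g + d * β₂ g = 0} ∧
        ((kreinAdjoint T).domain : Set L2R) = parity '' ((T†).domain : Set L2R) ∧
        ((kreinAdjoint T).domain : Set L2R) =
            toL2 q '' {h | a * β₁ h - b * β₂ h + c * α₁ h - d * α₂ h = 0}) ∧
    (∀ c₁ d₁ : ℂ, ‖c₁‖ + ‖d₁‖ ≠ 0 →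
      (T.domain : Set L2R) = toL2 q '' {f | c₁ * β₁ f + d₁ * β₂ f = 0 ∧
        !![α, β; γ, δ] *ᵥ ![β₁ f, β₂ f] = ![α₁ f, α₂ f]} →
      ∀ a b c d : ℂ, c = conj c₁ → d = conj d₁ →
        ![a, b] = -(!![conj δ, -conj γ; -conj β, conj α] *ᵥ ![conj c₁, conj d₁]) →
        ((T†).domain : Set L2R) =
            toL2 q '' {g | a * α₁ g + b * α₂ g + c * β₁ g + d * β₂ g = 0} ∧
        ((kreinAdjoint T).domain : Set L2R) = parity '' ((T†).domain : Set L2R) ∧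
        ((kreinAdjoint T).domain : Set L2R) =
            toL2 q '' {h | a * β₁ h - b * β₂ h + c * α₁ h - d * α₂ h = 0}) := by
  obtain rfl : α₁ = fun f : maxDomain q => bracketBot w₁ f := funext hα₁
  obtain rfl : α₂ = fun f : maxDomain q => bracketBot w₂ f := funext hα₂
  obtain rfl : β₁ = fun f : maxDomain q => bracketTop w₁ f := funext hβ₁
  obtain rfl : β₂ = fun f : maxDomain q => bracketTop w₂ f := funext hβ₂
  constructor
  · rintro a₁ b₁ hab hdom _ _ c d rfl rfl hcd
    refine adjoint_domains hq_even hw hT hdom fun g => ?_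
    simp only [hw.bracketBot_eq, hw.bracketTop_eq]
    exact forall_boundary_form_eq_iff hw.exists_boundary_values g hab hcd
  · rintro c₁ d₁ hcd hdom a b _ _ rfl rfl hab
    refine adjoint_domains hq_even hw hT hdom fun g => ?_
    simp only [hw.bracketBot_eq, hw.bracketTop_eq]
    -- Type II is type I with the ends exchanged; the condition equates the forms at the two ends,
    -- so the exchange only swaps the sides of the equality.
    have hsurj : ∀ b₁ b₂ a₁ a₂ : ℂ, ∃ y : maxDomain q, bracketTop w₁ y = b₁ ∧
        bracketTop w₂ y = b₂ ∧ bracketBot w₁ y = a₁ ∧ bracketBot w₂ y = a₂ := by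
      intro b₁ b₂ a₁ a₂
      obtain ⟨y, h1, h2, h3, h4⟩ := hw.exists_boundary_values a₁ a₂ b₁ b₂
      exact ⟨y, h3, h4, h1, h2⟩
    have h := forall_boundary_form_eq_iff hsurj g hcd hab
    refine Iff.trans ⟨fun H f hf => (H f hf).symm, fun H f hf => (H f hf).symm⟩ (h.trans ?_)
    constructor <;> intro e <;> linear_combination e
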